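/- Let $F$ be a field and let $\Gamma=(V,E,s,r)$ be a finite directed graph (loops and multiple edges are allowed). A vertex $v$ is a sink if $s^{-1}(v)=\emptyset$. Vertices are viewed as paths of length $0$; $l(p)$, $s(p)$ and $r(p)$ denote the length, the source and the range of a path $p$. A vertex $w$ is a descendant of $v$ if there is a path from $v$ to $w$. A nonempty subset $W\subseteq V$ is hereditary if it contains all descendants of its elements. Let $L(\Gamma)$ be the Leavitt path algebra of $\Gamma$ over $F$, generated by $V\cup\{e,e^*\mid e\in E\}$ with the relations: $vw=\delta_{v,w}v$ for $v,w\in V$; $s(e)e=er(e)=e$ and $r(e)e^*=e^*s(e)=e^*$ for $e\in E$; $e^*f=\delta_{e,f}r(e)$ for $e,f\in E$; $v=\sum_{s(e)=v}ee^*$ for every vertex $v$ that is not a sink. Its unit is $1=\sum_{v\in V}v$. It is $\mathbb Z$-graded, $L(\Gamma)=\bigoplus_i L(\Gamma)_i$, with $\deg v=0$, $\deg e=1$, $\deg e^*=-1$. For a path $p=e_1\cdots e_n$ put $p^*=e_n^*\cdots e_1^*$ (and $v^*=v$ for a vertex $v$). Fix a specialization, that is, a map $\gamma$ from the set of vertices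 that are not sinks to $E$ with $s(\gamma(v))=v$. The edges in the image of $\gamma$ are called special. For a path $p$ let $\mathrm{sd}(p)$ be the length of the longest terminal segment of $p$ that consists of special edges. For real $n,s,d\ge 0$ let $V_{n,s,d}$ be the $F$-span of all $pq^*$ with $p,q$ paths, $l(p)+l(q)\ge n$, $\mathrm{sd}(p)+\mathrm{sd}(q)\le s$, $|l(p)-l(q)|\le d$, and for $k\ge1$ let $V_k=\sum\{V_{n,s,d}\mid n\ge k(s+d+1)\}$. The subspaces $V_k$, $k\geq 1$, form a basis of neighbourhoods of $0$ of a topology on $L(\Gamma)$ that makes it a topological algebra. Let $\overline{L(\Gamma)}$ be its completion, let $\overline{L(\Gamma)_i}$ be the closure of $L(\Gamma)_i$ in $\overline{L(\Gamma)}$, and let $\widehat L(\Gamma)=\sum_{i\in\mathbb Z}\overline{L(\Gamma)_i}$, with the topology induced from $\overline{L(\Gamma)}$. Ideals are two-sided; an ideal of $\widehat L(\Gamma)$ is graded if it is spanned by the homogeneous elements (elements of some $\overline{L(\Gamma)_i}$, $i\in\mathbb Z$) that it contains. For a hereditary set $W$ let $I(W)$ be the closed ideal of $\widehat L(\Gamma)$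 generated by $W$. For $v\in V$ define paths $g_v(n)$ by $g_v(0)=v$; $g_v(n+1)=g_v(n)\,\gamma(r(g_v(n)))$ if $r(g_v(n))$ is not a sink, and $g_v(n+1)=g_v(n)$ otherwise. Let $e_v=\lim_{n\to\infty}g_v(n)g_v(n)^*\in\widehat L(\Gamma)$. Then: (1) If $W\subseteq V$ is hereditary and $J$ is a nonzero closed graded ideal of $\widehat L(\Gamma)$ with $J\subseteq I(W)$, then there is a vertex $w\in W$ such that (the limit $e_w$ exists and) $e_w\in J$. (2) $\widehat L(\Gamma)$ has no nonzero closed graded nilpotent ideals. -/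

import Mathlib

open Filter Topology

noncomputable section

namespace Leavitt

/-- A directed graph (multiple edges and loops allowed) with vertex set `V`, edge set `E`,
source map `s` and range map `r`. -/
structure Graph (V E : Type*) where
  s : E → V
  r : E → V

namespace Graph

variable {V E : Type*} (G : Graph V E)

/-- A sink is a vertex that emits no edge. -/
def IsSink (v : V) : Prop := ∀ e : E, G.s e ≠ v

/-- `G.IsWalk u l t`: the sequence of edges `l` is composable, starts at `u` and ends at `t`. -/
def IsWalk : V → List E → V → Prop
  | u, [], t => u = t
  | u, e :: l, t => G.s e = u ∧ IsWalk (G.r e) l t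

/-- A path of the graph. Vertices are the paths without edges. -/
structure Path where
  source : V
  edges : List E
  range : V
  isWalk : G.IsWalk source edges range

variable {G}

/-- The length `l(p)` of a path. -/
def Path.length (p : G.Path) : ℕ := p.edges.length

/-- The vertex `v`, viewed as a path of length `0`. -/
def Path.nil (v : V) : G.Path := ⟨v, [], v, rfl⟩

theorem IsWalk.append {u t w : V} {l l' : List E} (h : G.IsWalk u l t) (h' : G.IsWalk t l' w) :
    G.IsWalk u (l ++ l') w := by
  induction l generalizing u with
  | nil => cases h; exact h'
  | cons e l ih => exact ⟨h.1, ih h.2⟩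

/-- The path `p e`, where `e` is an edge that starts where `p` ends. -/
def Path.snoc (p : G.Path) (e : E) (he : G.s e = p.range) : G.Path :=
  ⟨p.source, p.edges ++ [e], G.r e, p.isWalk.append ⟨he, rfl⟩⟩

variable (G)

/-- `w` is a descendant of `v` if there is a path from `v` to `w`. -/
def IsDescendant (v w : V) : Prop := ∃ p : G.Path, p.source = v ∧ p.range = w

/-- A hereditary set of vertices: nonempty and closed under descendants. -/
def IsHereditary (W : Set V) : Prop :=
  W.Nonempty ∧ ∀ w ∈ W, ∀ v, G.IsDescendant w v → v ∈ W

/-- A specialization chooses, for every vertex that is not a sink, an edge starting there. -/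
structure Specialization where
  edge : {v : V // ¬ G.IsSink v} → E
  source_edge : ∀ v, G.s (edge v) = v

namespace Specialization

variable {G} (γ : G.Specialization)

/-- Special edges are those in the image of the specialization. -/
def IsSpecial (e : E) : Prop := e ∈ Set.range γ.edge

open Classical in
/-- `sd(p)`: the length of the longest terminal segment of `p` that consists of special edges
(`0` for a vertex). -/
def sd (p : G.Path) : ℕ := (p.edges.rtakeWhile fun e => decide (γ.IsSpecial e)).length

open Classical in
/-- The paths `g_v(n)`: follow the special edges for `n` steps, or until a sink is reached. -/
def g (v : V) : ℕ → G.Path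
  | 0 => Path.nil v
  | n + 1 =>
    if h : G.IsSink (g v n).range then g v n
    else (g v n).snoc (γ.edge ⟨_, h⟩) (γ.source_edge ⟨_, h⟩)

end Specialization

end Graph

/-- The generators of the Leavitt path algebra: vertices, edges `e`, ghost edges `e*`. -/
inductive Gen (V E : Type*)
  | vtx (v : V)
  | edge (e : E)
  | ghost (e : E)

section LPA

variable {V E : Type*} [Fintype V] [Fintype E] (F : Type*) [Field F] (G : Graph V E)

open Classical in
/-- The defining relations. As the algebra is presented here as a unital algebra, the relation
that identifies `1` with the sum of all vertices has to be listed. -/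
inductive Rel : FreeAlgebra F (Gen V E) → FreeAlgebra F (Gen V E) → Prop
  | one : Rel (∑ v : V, FreeAlgebra.ι F (Gen.vtx v)) 1
  | vtx_self (v : V) : Rel (FreeAlgebra.ι F (.vtx v) * FreeAlgebra.ι F (.vtx v))
      (FreeAlgebra.ι F (.vtx v))
  | vtx_ne (v w : V) : v ≠ w → Rel (FreeAlgebra.ι F (.vtx v) * FreeAlgebra.ι F (.vtx w)) 0
  | source_edge (e : E) : Rel (FreeAlgebra.ι F (.vtx (G.s e)) * FreeAlgebra.ι F (.edge e))
      (FreeAlgebra.ι F (.edge e))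
  | edge_range (e : E) : Rel (FreeAlgebra.ι F (.edge e) * FreeAlgebra.ι F (.vtx (G.r e)))
      (FreeAlgebra.ι F (.edge e))
  | range_ghost (e : E) : Rel (FreeAlgebra.ι F (.vtx (G.r e)) * FreeAlgebra.ι F (.ghost e))
      (FreeAlgebra.ι F (.ghost e))
  | ghost_source (e : E) : Rel (FreeAlgebra.ι F (.ghost e) * FreeAlgebra.ι F (.vtx (G.s e)))
      (FreeAlgebra.ι F (.ghost e))
  | ghost_edge_self (e : E) : Rel (FreeAlgebra.ι F (.ghost e) * FreeAlgebra.ι F (.edge e))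
      (FreeAlgebra.ι F (.vtx (G.r e)))
  | ghost_edge_ne (e f : E) : e ≠ f →
      Rel (FreeAlgebra.ι F (.ghost e) * FreeAlgebra.ι F (.edge f)) 0
  | sum_edge_ghost (v : V) : ¬ G.IsSink v →
      Rel (∑ e : E with G.s e = v, FreeAlgebra.ι F (.edge e) * FreeAlgebra.ι F (.ghost e))
        (FreeAlgebra.ι F (.vtx v))

/-- The Leavitt path algebra `L(Γ)` over `F`. -/
def LPA : Type _ := RingQuot (Rel F G)

instance : Ring (LPA F G) := inferInstanceAs (Ring (RingQuot (Rel F G)))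
instance : Algebra F (LPA F G) := inferInstanceAs (Algebra F (RingQuot (Rel F G)))

namespace LPA

variable {G}

/-- The class of a generator. -/
def of (x : Gen V E) : LPA F G := RingQuot.mkAlgHom F (Rel F G) (FreeAlgebra.ι F x)

variable (G) in
/-- A vertex as an element of the algebra. -/
def vtx (v : V) : LPA F G := of F (.vtx v)

variable (G) in
/-- An edge as an element of the algebra. -/
def edge (e : E) : LPA F G := of F (.edge e)

variable (G) in
/-- A ghost edge `e*` as an element of the algebra. -/
def ghost (e : E) : LPA F G := of F (.ghost e)

/-- The path `p = e₁ ⋯ eₙ` as an element of the algebra (the vertex itself if `n = 0`). -/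
def path (p : G.Path) : LPA F G := vtx F G p.source * (p.edges.map (edge F G)).prod

/-- The element `p* = eₙ* ⋯ e₁*` of the algebra (the vertex itself if `n = 0`). -/
def pathStar (p : G.Path) : LPA F G :=
  (p.edges.map (ghost F G)).reverse.prod * vtx F G p.source

/-- The product `p q*`. -/
def mono (p q : G.Path) : LPA F G := path F p * pathStar F q

variable (G) in
/-- The homogeneous component of degree `i`, for the grading with
`deg v = 0`, `deg e = 1`, `deg e* = -1`. -/
def component (i : ℤ) : Submodule F (LPA F G) :=
  Submodule.span F {x | ∃ p q : G.Path, p.range = q.range ∧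
    (p.length : ℤ) - q.length = i ∧ x = mono F p q}

variable (γ : G.Specialization)

/-- The subspace `V_{n,s,d}`, spanned by the products `p q*` with `l(p) + l(q) ≥ n`,
`sd(p) + sd(q) ≤ s`, `|l(p) - l(q)| ≤ d` (products with `r(p) ≠ r(q)` vanish). -/
def subspaceNSD (n s d : ℝ) : Submodule F (LPA F G) :=
  Submodule.span F {x | ∃ p q : G.Path, p.range = q.range ∧
    n ≤ (p.length : ℝ) + q.length ∧ (γ.sd p : ℝ) + γ.sd q ≤ s ∧
    |(p.length : ℝ) - q.length| ≤ d ∧ x = mono F p q}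

/-- The subspace `V_k`: the sum of all `V_{n,s,d}` with `n, s, d ≥ 0` and `n ≥ k (s + d + 1)`. -/
def subspaceK (k : ℕ) : Submodule F (LPA F G) :=
  ⨆ t : {t : ℝ × ℝ × ℝ // 0 ≤ t.1 ∧ 0 ≤ t.2.1 ∧ 0 ≤ t.2.2 ∧ (k : ℝ) * (t.2.1 + t.2.2 + 1) ≤ t.1},
    subspaceNSD F γ t.1.1 t.1.2.1 t.1.2.2

/-! ### The subspaces `V_k` define a ring topology -/

section Basic

variable {F}

theorem vtx_sum : ∑ v : V, vtx F G v = 1 := by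
  have := RingQuot.mkAlgHom_rel F (Rel.one (F := F) (G := G))
  rw [map_sum, map_one] at this; exact this

theorem vtx_mul_self (v : V) : vtx F G v * vtx F G v = vtx F G v := by
  have := RingQuot.mkAlgHom_rel F (Rel.vtx_self (F := F) (G := G) v)
  rw [map_mul] at this; exact this

theorem vtx_mul_ne {v w : V} (h : v ≠ w) : vtx F G v * vtx F G w = 0 := by
  have := RingQuot.mkAlgHom_rel F (Rel.vtx_ne (F := F) (G := G) v w h)
  rw [map_mul, map_zero] at this; exact this

theorem source_mul_edge (e : E) : vtx F G (G.s e) * edge F G e = edge F G e := by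
  have := RingQuot.mkAlgHom_rel F (Rel.source_edge (F := F) (G := G) e)
  rw [map_mul] at this; exact this

theorem edge_mul_range (e : E) : edge F G e * vtx F G (G.r e) = edge F G e := by
  have := RingQuot.mkAlgHom_rel F (Rel.edge_range (F := F) (G := G) e)
  rw [map_mul] at this; exact this

theorem range_mul_ghost (e : E) : vtx F G (G.r e) * ghost F G e = ghost F G e := by
  have := RingQuot.mkAlgHom_rel F (Rel.range_ghost (F := F) (G := G) e)
  rw [map_mul] at this; exact this

theorem ghost_mul_source (e : E) : ghost F G e * vtx F G (G.s e) = ghost F G e := by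
  have := RingQuot.mkAlgHom_rel F (Rel.ghost_source (F := F) (G := G) e)
  rw [map_mul] at this; exact this

theorem ghost_mul_edge_self (e : E) : ghost F G e * edge F G e = vtx F G (G.r e) := by
  have := RingQuot.mkAlgHom_rel F (Rel.ghost_edge_self (F := F) (G := G) e)
  rw [map_mul] at this; exact this

theorem ghost_mul_edge_ne {e f : E} (h : e ≠ f) : ghost F G e * edge F G f = 0 := by
  have := RingQuot.mkAlgHom_rel F (Rel.ghost_edge_ne (F := F) (G := G) e f h)
  rw [map_mul, map_zero] at this; exact this

theorem walk_cons {u : V} {e : E} (h : G.s e = u) (l : List E) :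
    vtx F G u * ((e :: l).map (edge F G)).prod
      = edge F G e * (vtx F G (G.r e) * (l.map (edge F G)).prod) := by
  subst h
  rw [List.map_cons, List.prod_cons, ← mul_assoc, source_mul_edge, ← mul_assoc, edge_mul_range]

theorem ghostWalk_cons {u : V} {e : E} (h : G.s e = u) (l : List E) :
    ((e :: l).map (ghost F G)).reverse.prod * vtx F G u
      = ((l.map (ghost F G)).reverse.prod * vtx F G (G.r e)) * ghost F G e := by
  subst h
  rw [List.map_cons, List.reverse_cons, List.prod_append, List.prod_singleton, mul_assoc,
    ghost_mul_source, mul_assoc, range_mul_ghost]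

theorem walk_append {u t : V} {l l' : List E} (h : G.IsWalk u l t) :
    (vtx F G u * (l.map (edge F G)).prod) * (vtx F G t * (l'.map (edge F G)).prod)
      = vtx F G u * ((l ++ l').map (edge F G)).prod := by
  induction l generalizing u with
  | nil => cases h; simp [← mul_assoc, vtx_mul_self]
  | cons e l ih =>
    rw [List.cons_append, walk_cons h.1, walk_cons h.1, mul_assoc, ih h.2]

theorem ghostWalk_append {u t : V} {l l' : List E} (h : G.IsWalk u l t) :
    ((l'.map (ghost F G)).reverse.prod * vtx F G t) *
        ((l.map (ghost F G)).reverse.prod * vtx F G u)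
      = ((l ++ l').map (ghost F G)).reverse.prod * vtx F G u := by
  induction l generalizing u with
  | nil => cases h; simp [mul_assoc, vtx_mul_self]
  | cons e l ih =>
    rw [List.cons_append, ghostWalk_cons h.1, ghostWalk_cons h.1, ← mul_assoc, ih h.2]

theorem ghostWalk_mul_walk {u t v t' : V} {p q : List E} (hp : G.IsWalk u p t)
    (hq : G.IsWalk v q t') :
    ((p.map (ghost F G)).reverse.prod * vtx F G u) * (vtx F G v * (q.map (edge F G)).prod) = 0 ∨
    (∃ q', q = p ++ q' ∧ v = u ∧ G.IsWalk t q' t' ∧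
      ((p.map (ghost F G)).reverse.prod * vtx F G u) * (vtx F G v * (q.map (edge F G)).prod)
        = vtx F G t * (q'.map (edge F G)).prod) ∨
    (∃ p', p = q ++ p' ∧ v = u ∧ G.IsWalk t' p' t ∧
      ((p.map (ghost F G)).reverse.prod * vtx F G u) * (vtx F G v * (q.map (edge F G)).prod)
        = (p'.map (ghost F G)).reverse.prod * vtx F G t') := by
  by_cases huv : u = v
  swap
  · left
    rw [mul_assoc, ← mul_assoc (vtx F G u), vtx_mul_ne huv, zero_mul, mul_zero]
  subst huv
  induction p generalizing u q with
  | nil =>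
    cases hp
    exact Or.inr (Or.inl ⟨q, rfl, rfl, hq, by simp [← mul_assoc, vtx_mul_self]⟩)
  | cons e p ih =>
    cases q with
    | nil =>
      cases hq
      exact Or.inr (Or.inr ⟨e :: p, rfl, rfl, hp, by simp [mul_assoc, vtx_mul_self]⟩)
    | cons f q =>
      rw [ghostWalk_cons hp.1, walk_cons hq.1]
      by_cases hef : e = f
      · subst hef
        have key : ∀ a b : LPA F G, a * vtx F G (G.r e) * ghost F G e *
            (edge F G e * (vtx F G (G.r e) * b))
            = a * vtx F G (G.r e) * (vtx F G (G.r e) * b) := by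
          intro a b
          rw [mul_assoc, ← mul_assoc (ghost F G e), ghost_mul_edge_self, ← mul_assoc (vtx F G _)
            (vtx F G _), vtx_mul_self]
        rw [key]
        rcases ih hp.2 hq.2 with h | ⟨q', h1, -, h2, h3⟩ | ⟨p', h1, -, h2, h3⟩
        · exact Or.inl h
        · exact Or.inr (Or.inl ⟨q', by rw [h1, List.cons_append], rfl, h2, h3⟩)
        · exact Or.inr (Or.inr ⟨p', by rw [h1, List.cons_append], rfl, h2, h3⟩)
      · left
        rw [mul_assoc, ← mul_assoc (ghost F G e), ghost_mul_edge_ne hef, zero_mul, mul_zero]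

theorem takeWhile_le_append {α : Type*} (P : α → Bool) (a b : List α) :
    (a.takeWhile P).length ≤ ((a ++ b).takeWhile P).length := by
  induction a with
  | nil => simp
  | cons x a ih =>
    rw [List.cons_append, List.takeWhile_cons, List.takeWhile_cons]
    split <;> simp [ih]

theorem takeWhile_append_le {α : Type*} (P : α → Bool) (a b : List α) :
    ((a ++ b).takeWhile P).length ≤ (a.takeWhile P).length + (b.takeWhile P).length := by
  induction a with
  | nil => simp
  | cons x a ih =>
    rw [List.cons_append, List.takeWhile_cons, List.takeWhile_cons]
    split
    · simp only [List.length_cons]; omega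
    · simp

theorem rtakeWhile_append_le {α : Type*} (P : α → Bool) (a b : List α) :
    ((a ++ b).rtakeWhile P).length ≤ (a.rtakeWhile P).length + (b.rtakeWhile P).length := by
  simp only [List.rtakeWhile, List.length_reverse, List.reverse_append]
  rw [add_comm]
  exact takeWhile_append_le P _ _

theorem rtakeWhile_le_append {α : Type*} (P : α → Bool) (a b : List α) :
    (b.rtakeWhile P).length ≤ ((a ++ b).rtakeWhile P).length := by
  simp only [List.rtakeWhile, List.length_reverse, List.reverse_append]
  exact takeWhile_le_append P _ _

/-- The product of two elements `p₁ q₁*`, `p₂ q₂*` is zero or again of this form. -/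
theorem mono_mul_mono {p₁ q₁ p₂ q₂ : G.Path} (h₁ : p₁.range = q₁.range)
    (h₂ : p₂.range = q₂.range) :
    mono F p₁ q₁ * mono F p₂ q₂ = 0 ∨
    ∃ p q : G.Path, p.range = q.range ∧ mono F p₁ q₁ * mono F p₂ q₂ = mono F p q ∧
      p₁.length + q₂.length ≤ p.length + q.length ∧
      γ.sd p + γ.sd q ≤ γ.sd p₁ + γ.sd q₁ + (γ.sd p₂ + γ.sd q₂) ∧
      (p.length : ℤ) - q.length
        = ((p₁.length : ℤ) - q₁.length) + ((p₂.length : ℤ) - q₂.length) := by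
  obtain ⟨u₁, l₁, t₁, w₁⟩ := p₁
  obtain ⟨v₁, m₁, t₁', x₁⟩ := q₁
  obtain ⟨u₂, l₂, t₂, w₂⟩ := p₂
  obtain ⟨v₂, m₂, t₂', x₂⟩ := q₂
  dsimp only at h₁ h₂
  subst h₁ h₂
  simp only [mono, path, pathStar, Graph.Path.length]
  rw [mul_assoc, ← mul_assoc ((m₁.map (ghost F G)).reverse.prod * vtx F G v₁)]
  rcases ghostWalk_mul_walk (F := F) x₁ w₂ with h | ⟨l', h1, -, h2, h3⟩ | ⟨m', h1, -, h2, h3⟩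
  · left; rw [h, zero_mul, mul_zero]
  · right
    refine ⟨⟨u₁, l₁ ++ l', t₂, w₁.append h2⟩, ⟨v₂, m₂, t₂, x₂⟩, rfl, ?_, ?_, ?_, ?_⟩
    · rw [h3, ← mul_assoc, walk_append w₁]
    · simp
    · simp only [Graph.Specialization.sd, h1]
      have a := rtakeWhile_append_le (fun e => @decide (γ.IsSpecial e)
        (Classical.propDecidable _)) l₁ l'
      have b := rtakeWhile_le_append (fun e => @decide (γ.IsSpecial e)
        (Classical.propDecidable _)) m₁ l'
      omega
    · simp only [h1, List.length_append]; push_cast; ring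
  · right
    refine ⟨⟨u₁, l₁, t₁, w₁⟩, ⟨v₂, m₂ ++ m', t₁, x₂.append h2⟩, rfl, ?_, ?_, ?_, ?_⟩
    · rw [h3, ghostWalk_append x₂]
    · simp
    · simp only [Graph.Specialization.sd, h1]
      have a := rtakeWhile_append_le (fun e => @decide (γ.IsSpecial e)
        (Classical.propDecidable _)) m₂ m'
      have b := rtakeWhile_le_append (fun e => @decide (γ.IsSpecial e)
        (Classical.propDecidable _)) l₂ m'
      omega
    · simp only [h1, List.length_append]; push_cast; ring

/-- `V_k` is spanned by the `p q*` with `l(p) + l(q) ≥ k (sd(p) + sd(q) + |l(p) - l(q)| + 1)`. -/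
theorem subspaceK_eq_span (k : ℕ) :
    subspaceK F γ k = Submodule.span F {x | ∃ p q : G.Path, p.range = q.range ∧
      (k : ℝ) * ((γ.sd p + γ.sd q : ℝ) + |(p.length : ℝ) - q.length| + 1)
        ≤ (p.length : ℝ) + q.length ∧ x = mono F p q} := by
  apply le_antisymm
  · refine iSup_le ?_
    rintro ⟨⟨n, s, d⟩, hn, hs, hd, h⟩
    refine Submodule.span_mono ?_
    rintro x ⟨p, q, hr, h1, h2, h3, rfl⟩
    refine ⟨p, q, hr, ?_, rfl⟩
    refine le_trans ?_ (h.trans h1)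
    gcongr
  · refine Submodule.span_le.2 ?_
    rintro x ⟨p, q, hr, h, rfl⟩
    refine Submodule.mem_iSup_of_mem ⟨((p.length : ℝ) + q.length, (γ.sd p : ℝ) + γ.sd q,
      |(p.length : ℝ) - q.length|), by positivity, by positivity, by positivity, h⟩ ?_
    exact Submodule.subset_span ⟨p, q, hr, le_rfl, le_rfl, le_rfl, rfl⟩

theorem subspaceK_anti {k k' : ℕ} (h : k ≤ k') : subspaceK F γ k' ≤ subspaceK F γ k := by
  rw [subspaceK_eq_span, subspaceK_eq_span]
  refine Submodule.span_mono ?_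
  rintro x ⟨p, q, hr, h1, rfl⟩
  refine ⟨p, q, hr, le_trans ?_ h1, rfl⟩
  gcongr

theorem abs_diff_le {a b : ℕ} {c : ℝ} (h : |(a : ℝ) - b| = c) : (a : ℝ) + b - c ≤ 2 * a ∧
    (a : ℝ) + b - c ≤ 2 * b := by
  have h1 := le_abs_self ((a : ℝ) - b)
  have h2 := neg_abs_le ((a : ℝ) - b)
  constructor <;> linarith

/-- The estimate behind both continuity statements. -/
theorem mono_mul_mono_est {p₁ q₁ p₂ q₂ : G.Path} (h₁ : p₁.range = q₁.range)
    (h₂ : p₂.range = q₂.range) {k : ℕ}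
    (h : (2 * k : ℝ) * ((γ.sd p₁ + γ.sd q₁ : ℝ) + (γ.sd p₂ + γ.sd q₂)
        + (|(p₁.length : ℝ) - q₁.length| + |(p₂.length : ℝ) - q₂.length|) + 1)
        + |(p₁.length : ℝ) - q₁.length| + |(p₂.length : ℝ) - q₂.length|
        ≤ (p₁.length : ℝ) + q₁.length + (p₂.length + q₂.length)) :
    mono F p₁ q₁ * mono F p₂ q₂ ∈ subspaceK F γ k := by
  rcases mono_mul_mono (F := F) γ h₁ h₂ with h0 | ⟨p, q, hr, h0, hl, hs, hd⟩
  · rw [h0]; exact zero_mem _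
  rw [h0, subspaceK_eq_span]
  refine Submodule.subset_span ⟨p, q, hr, ?_, rfl⟩
  have a1 := (abs_diff_le (a := p₁.length) (b := q₁.length) rfl).1
  have a2 := (abs_diff_le (a := p₂.length) (b := q₂.length) rfl).2
  have hl' : (p₁.length : ℝ) + q₂.length ≤ p.length + q.length := by exact_mod_cast hl
  have hs' : (γ.sd p + γ.sd q : ℝ) ≤ (γ.sd p₁ + γ.sd q₁ : ℝ) + (γ.sd p₂ + γ.sd q₂) := by
    exact_mod_cast hs
  have hd0 : (p.length : ℝ) - q.length
      = ((p₁.length : ℝ) - q₁.length) + ((p₂.length : ℝ) - q₂.length) := by exact_mod_cast hd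
  have hd' : |(p.length : ℝ) - q.length|
      ≤ |(p₁.length : ℝ) - q₁.length| + |(p₂.length : ℝ) - q₂.length| := by
    rw [hd0]; exact abs_add_le _ _
  have : (k : ℝ) * ((γ.sd p + γ.sd q : ℝ) + |(p.length : ℝ) - q.length| + 1) ≤
      (k : ℝ) * ((γ.sd p₁ + γ.sd q₁ : ℝ) + (γ.sd p₂ + γ.sd q₂)
        + (|(p₁.length : ℝ) - q₁.length| + |(p₂.length : ℝ) - q₂.length|) + 1) := by
    gcongr
  linarith

theorem subspaceK_mul (k : ℕ) {x y : LPA F G} (hx : x ∈ subspaceK F γ (2 * k + 1))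
    (hy : y ∈ subspaceK F γ (2 * k + 1)) : x * y ∈ subspaceK F γ k := by
  rw [subspaceK_eq_span] at hx hy
  induction hx using Submodule.span_induction with
  | zero => rw [zero_mul]; exact zero_mem _
  | add a b _ _ ha hb => rw [add_mul]; exact add_mem ha hb
  | smul c a _ ha => rw [smul_mul_assoc]; exact Submodule.smul_mem _ _ ha
  | mem x hx =>
    obtain ⟨p₁, q₁, hr₁, h1, rfl⟩ := hx
    induction hy using Submodule.span_induction with
    | zero => rw [mul_zero]; exact zero_mem _
    | add a b _ _ ha hb => rw [mul_add]; exact add_mem ha hb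
    | smul c a _ ha => rw [mul_smul_comm]; exact Submodule.smul_mem _ _ ha
    | mem y hy =>
      obtain ⟨p₂, q₂, hr₂, h2, rfl⟩ := hy
      apply mono_mul_mono_est γ hr₁ hr₂
      push_cast at h1 h2
      have b1 : (0 : ℝ) ≤ γ.sd p₁ + γ.sd q₁ := by positivity
      have b2 : (0 : ℝ) ≤ γ.sd p₂ + γ.sd q₂ := by positivity
      have b3 : (0 : ℝ) ≤ k := by positivity
      nlinarith

/-- Multiplication by a fixed `a`, on either side, is continuous at `0`. -/
def ContAt (a : LPA F G) : Prop :=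
  ∀ k : ℕ, ∃ k' : ℕ, ∀ x ∈ subspaceK F γ k', a * x ∈ subspaceK F γ k ∧ x * a ∈ subspaceK F γ k

theorem contAt_mono {p q : G.Path} (h : p.range = q.range) : ContAt γ (mono F p q) := by
  intro k
  set c : ℕ := 2 * k * (γ.sd p + γ.sd q + p.length + q.length + 1) + p.length + q.length with hc
  refine ⟨2 * k + 1 + c, fun x hx => ?_⟩
  rw [subspaceK_eq_span] at hx
  induction hx using Submodule.span_induction with
  | zero => rw [zero_mul, mul_zero]; exact ⟨zero_mem _, zero_mem _⟩
  | add a b _ _ ha hb =>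
    rw [add_mul, mul_add]; exact ⟨add_mem ha.1 hb.1, add_mem ha.2 hb.2⟩
  | smul r a _ ha =>
    rw [smul_mul_assoc, mul_smul_comm]
    exact ⟨Submodule.smul_mem _ _ ha.1, Submodule.smul_mem _ _ ha.2⟩
  | mem x hx =>
    obtain ⟨p', q', hr, h1, rfl⟩ := hx
    have hc' : (c : ℝ) = 2 * k * (γ.sd p + γ.sd q + p.length + q.length + 1)
      + p.length + q.length := by rw [hc]; push_cast; ring
    have hd : |(p.length : ℝ) - q.length| ≤ p.length + q.length := by
      rw [abs_le]
      have : (0 : ℝ) ≤ p.length := by positivity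
      have : (0 : ℝ) ≤ q.length := by positivity
      constructor <;> linarith
    push_cast at h1
    have b1 : (0 : ℝ) ≤ γ.sd p + γ.sd q := by positivity
    have b2 : (0 : ℝ) ≤ γ.sd p' + γ.sd q' := by positivity
    have b3 : (0 : ℝ) ≤ k := by positivity
    have b4 := abs_nonneg ((p'.length : ℝ) - q'.length)
    have b5 : (0 : ℝ) ≤ c := by positivity
    have b6 : (0 : ℝ) ≤ p.length + q.length := by positivity
    have b7 : (k : ℝ) * |(p.length : ℝ) - q.length| ≤ k * (p.length + q.length) := by gcongr
    have b8 : 0 ≤ (c : ℝ) * ((γ.sd p' + γ.sd q' : ℝ) + |(p'.length : ℝ) - q'.length|) := by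
      positivity
    constructor
    · apply mono_mul_mono_est γ h hr
      nlinarith
    · apply mono_mul_mono_est γ hr h
      nlinarith

theorem contAt_add {a b : LPA F G} (ha : ContAt γ a) (hb : ContAt γ b) : ContAt γ (a + b) := by
  intro k
  obtain ⟨m, hm⟩ := ha k
  obtain ⟨n, hn⟩ := hb k
  refine ⟨max m n, fun x hx => ?_⟩
  have h1 := hm x (subspaceK_anti γ (le_max_left m n) hx)
  have h2 := hn x (subspaceK_anti γ (le_max_right m n) hx)
  rw [add_mul, mul_add]
  exact ⟨add_mem h1.1 h2.1, add_mem h1.2 h2.2⟩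

theorem contAt_mul {a b : LPA F G} (ha : ContAt γ a) (hb : ContAt γ b) : ContAt γ (a * b) := by
  intro k
  obtain ⟨m, hm⟩ := ha k
  obtain ⟨n, hn⟩ := hb k
  obtain ⟨m', hm'⟩ := ha n
  obtain ⟨n', hn'⟩ := hb m
  refine ⟨max m' n', fun x hx => ?_⟩
  have h1 := hm' x (subspaceK_anti γ (le_max_left _ _) hx)
  have h2 := hn' x (subspaceK_anti γ (le_max_right _ _) hx)
  rw [mul_assoc, ← mul_assoc x]
  exact ⟨(hm _ h2.1).1, (hn _ h1.2).2⟩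

theorem contAt_algebraMap (c : F) : ContAt γ (algebraMap F (LPA F G) c) := by
  intro k
  refine ⟨k, fun x hx => ?_⟩
  rw [← Algebra.commutes, ← Algebra.smul_def]
  exact ⟨Submodule.smul_mem _ _ hx, Submodule.smul_mem _ _ hx⟩

theorem vtx_eq_mono (v : V) : (of F (.vtx v) : LPA F G) = mono F (.nil v) (.nil v) := by
  have : mono F (.nil v) (.nil v) = vtx F G v := by
    simp [mono, path, pathStar, Graph.Path.nil, vtx_mul_self]
  rw [this, vtx]

theorem edge_eq_mono (e : E) :
    (of F (.edge e) : LPA F G) = mono F ⟨G.s e, [e], G.r e, rfl, rfl⟩ (.nil (G.r e)) := by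
  simp only [mono, path, pathStar, Graph.Path.nil, List.map_cons, List.map_nil,
    List.prod_singleton, List.reverse_nil, List.prod_nil, one_mul, source_mul_edge,
    edge_mul_range]
  rfl

theorem ghost_eq_mono (e : E) :
    (of F (.ghost e) : LPA F G) = mono F (.nil (G.r e)) ⟨G.s e, [e], G.r e, rfl, rfl⟩ := by
  simp only [mono, path, pathStar, Graph.Path.nil, List.map_cons, List.map_nil,
    List.prod_nil, mul_one, List.reverse_singleton, List.prod_singleton, ghost_mul_source,
    range_mul_ghost]
  rfl

theorem contAt_of (x : Gen V E) : ContAt γ (of F x : LPA F G) := by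
  cases x with
  | vtx v => rw [vtx_eq_mono]; exact contAt_mono γ rfl
  | edge e => rw [edge_eq_mono]; exact contAt_mono γ rfl
  | ghost e => rw [ghost_eq_mono]; exact contAt_mono γ rfl

theorem contAt (a : LPA F G) : ContAt γ a := by
  obtain ⟨y, rfl⟩ := RingQuot.mkAlgHom_surjective F (Rel F G) a
  induction y using FreeAlgebra.induction with
  | grade0 c => rw [AlgHom.commutes]; exact contAt_algebraMap γ c
  | grade1 x => exact contAt_of γ x
  | mul a b ha hb => rw [map_mul]; exact contAt_mul γ ha hb
  | add a b ha hb => rw [map_add]; exact contAt_add γ ha hb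

variable (F) in
/-- The subspaces `V_k`, `k ≥ 1`, form a neighbourhood basis of `0` for a ring topology. -/
theorem ringSubgroupsBasis :
    RingSubgroupsBasis fun k : ℕ => (subspaceK F γ (k + 1)).toAddSubgroup where
  inter i j := ⟨max i j, le_inf (subspaceK_anti γ (by simp)) (subspaceK_anti γ (by simp))⟩
  mul i := by
    refine ⟨2 * (i + 1), ?_⟩
    rintro _ ⟨x, hx, y, hy, rfl⟩
    exact subspaceK_mul γ (i + 1) hx hy
  leftMul x i := by
    obtain ⟨k, hk⟩ := contAt γ x (i + 1)
    exact ⟨k, fun y hy => (hk y (subspaceK_anti γ (Nat.le_succ k) hy)).1⟩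
  rightMul x i := by
    obtain ⟨k, hk⟩ := contAt γ x (i + 1)
    exact ⟨k, fun y hy => (hk y (subspaceK_anti γ (Nat.le_succ k) hy)).2⟩

theorem one_mem_component : (1 : LPA F G) ∈ component F G 0 := by
  rw [← vtx_sum]
  refine sum_mem fun v _ => Submodule.subset_span ⟨.nil v, .nil v, rfl, by simp, ?_⟩
  simpa [mono, path, pathStar, Graph.Path.nil] using (vtx_mul_self (F := F) (G := G) v).symm

theorem component_mul (γ : G.Specialization) {i j : ℤ} {x y : LPA F G} (hx : x ∈ component F G i)
    (hy : y ∈ component F G j) : x * y ∈ component F G (i + j) := by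
  induction hx using Submodule.span_induction with
  | zero => rw [zero_mul]; exact zero_mem _
  | add a b _ _ ha hb => rw [add_mul]; exact add_mem ha hb
  | smul c a _ ha => rw [smul_mul_assoc]; exact Submodule.smul_mem _ _ ha
  | mem x hx =>
    obtain ⟨p₁, q₁, hr₁, h1, rfl⟩ := hx
    induction hy using Submodule.span_induction with
    | zero => rw [mul_zero]; exact zero_mem _
    | add a b _ _ ha hb => rw [mul_add]; exact add_mem ha hb
    | smul c a _ ha => rw [mul_smul_comm]; exact Submodule.smul_mem _ _ ha
    | mem y hy =>
      obtain ⟨p₂, q₂, hr₂, h2, rfl⟩ := hy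
      rcases mono_mul_mono (F := F) γ hr₁ hr₂ with h0 | ⟨p, q, hr, h0, -, -, hd⟩
      · rw [h0]; exact zero_mem _
      · rw [h0]
        exact Submodule.subset_span ⟨p, q, hr, by omega, rfl⟩

end Basic

end LPA

/-! ### The completion -/

variable {G} (γ : G.Specialization)

/-- The algebra `L(Γ)` with the topology defined by the specialization `γ`. -/
def TopLPA (_ : G.Specialization) : Type _ := LPA F G

instance : Ring (TopLPA F γ) := inferInstanceAs (Ring (LPA F G))
instance : Algebra F (TopLPA F γ) := inferInstanceAs (Algebra F (LPA F G))

/-- The topology on `L(Γ)` in which the `V_k`, `k ≥ 1`, are a basis of neighbourhoods of `0`. -/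
instance : TopologicalSpace (TopLPA F γ) := (LPA.ringSubgroupsBasis F γ).topology

instance : IsTopologicalRing (TopLPA F γ) :=
  (LPA.ringSubgroupsBasis F γ).toRingFilterBasis.isTopologicalRing

instance : UniformSpace (TopLPA F γ) := IsTopologicalAddGroup.rightUniformSpace (TopLPA F γ)

instance : IsUniformAddGroup (TopLPA F γ) := isUniformAddGroup_of_addCommGroup

instance : UniformContinuousConstSMul F (TopLPA F γ) where
  uniformContinuous_const_smul c := by
    have h : Continuous (DistribSMul.toAddMonoidHom (TopLPA F γ) c) := by
      have : ⇑(DistribSMul.toAddMonoidHom (TopLPA F γ) c)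
          = fun x => algebraMap F (TopLPA F γ) c * x := by
        ext x; exact Algebra.smul_def c x
      rw [this]
      exact continuous_const_mul _
    exact uniformContinuous_addMonoidHom_of_continuous h

/-- The completion of the topological algebra `L(Γ)`. -/
abbrev FullCompletion : Type _ := UniformSpace.Completion (TopLPA F γ)

/-- The map from `L(Γ)` to its completion. -/
def toFull : LPA F G →ₐ[F] FullCompletion F γ :=
  { (UniformSpace.Completion.coeRingHom : TopLPA F γ →+* FullCompletion F γ) with
    commutes' := fun _ => rfl }

/-- The completion of the homogeneous component of degree `i`:
its closure in the completion of `L(Γ)`. -/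
def fullComponent (i : ℤ) : Submodule F (FullCompletion F γ) :=
  ((LPA.component F G i).map (toFull F γ).toLinearMap).topologicalClosure

variable {F γ} in
theorem toFull_mem_fullComponent {i : ℤ} {x : LPA F G} (hx : x ∈ LPA.component F G i) :
    toFull F γ x ∈ fullComponent F γ i :=
  Submodule.le_topologicalClosure _ ⟨x, hx, rfl⟩

variable {F γ} in
theorem fullComponent_mul {i j : ℤ} {x y : FullCompletion F γ} (hx : x ∈ fullComponent F γ i)
    (hy : y ∈ fullComponent F γ j) : x * y ∈ fullComponent F γ (i + j) := by
  refine map_mem_closure₂ (f := fun a b : FullCompletion F γ => a * b) continuous_mul hx hy ?_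
  rintro _ ⟨a, ha, rfl⟩ _ ⟨b, hb, rfl⟩
  exact ⟨a * b, LPA.component_mul γ ha hb, map_mul (toFull F γ) a b⟩

/-- The graded completion `L̂(Γ)`: the sum of the completions of the homogeneous components,
with the topology induced from the completion of `L(Γ)`. -/
def Hat : Subalgebra F (FullCompletion F γ) :=
  (⨆ i : ℤ, fullComponent F γ i).toSubalgebra
    (by
      refine Submodule.mem_iSup_of_mem 0 ?_
      have := toFull_mem_fullComponent (γ := γ) (LPA.one_mem_component (F := F) (G := G))
      rwa [map_one] at this)
    (by
      intro x y hx hy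
      induction hx using Submodule.iSup_induction' with
      | zero => rw [zero_mul]; exact zero_mem _
      | add a b _ _ ha hb => rw [add_mul]; exact add_mem ha hb
      | mem i x hx =>
        induction hy using Submodule.iSup_induction' with
        | zero => rw [mul_zero]; exact zero_mem _
        | add a b _ _ ha hb => rw [mul_add]; exact add_mem ha hb
        | mem j y hy => exact Submodule.mem_iSup_of_mem (i + j) (fullComponent_mul hx hy))

variable {F γ} in
theorem toFull_mem_Hat (x : LPA F G) : toFull F γ x ∈ Hat F γ := by
  obtain ⟨y, rfl⟩ := RingQuot.mkAlgHom_surjective F (Rel F G) x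
  induction y using FreeAlgebra.induction with
  | grade0 c =>
    have : toFull F γ (RingQuot.mkAlgHom F (Rel F G) (algebraMap F _ c)) = algebraMap F _ c := by
      rw [AlgHom.commutes]; exact AlgHom.commutes _ _
    rw [this]; exact Subalgebra.algebraMap_mem _ _
  | mul a b ha hb =>
    rw [map_mul]; exact (map_mul (toFull F γ) _ _).symm ▸ mul_mem ha hb
  | add a b ha hb =>
    rw [map_add]; exact (map_add (toFull F γ) _ _).symm ▸ add_mem ha hb
  | grade1 x =>
    cases x with
    | vtx v =>
      refine Submodule.mem_iSup_of_mem 0 (toFull_mem_fullComponent (Submodule.subset_span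
        ⟨.nil v, .nil v, rfl, by simp, ?_⟩))
      exact LPA.vtx_eq_mono v
    | edge e =>
      refine Submodule.mem_iSup_of_mem 1 (toFull_mem_fullComponent (Submodule.subset_span
        ⟨⟨G.s e, [e], G.r e, rfl, rfl⟩, .nil (G.r e), rfl, ?_, LPA.edge_eq_mono e⟩))
      simp [Graph.Path.length, Graph.Path.nil]
    | ghost e =>
      refine Submodule.mem_iSup_of_mem (-1) (toFull_mem_fullComponent (Submodule.subset_span
        ⟨.nil (G.r e), ⟨G.s e, [e], G.r e, rfl, rfl⟩, rfl, ?_, LPA.ghost_eq_mono e⟩))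
      simp [Graph.Path.length, Graph.Path.nil]

/-- The canonical map `L(Γ) → L̂(Γ)`. -/
def toHat : LPA F G →ₐ[F] Hat F γ := (toFull F γ).codRestrict (Hat F γ) toFull_mem_Hat

/-- The homogeneous elements of degree `i` in `L̂(Γ)`. -/
def hatComponent (i : ℤ) : Submodule F (Hat F γ) :=
  (fullComponent F γ i).comap (Hat F γ).val.toLinearMap

variable {F γ}

/-- An ideal of `L̂(Γ)` is graded if each of its elements is a finite sum of
homogeneous elements of the ideal. -/
def IsGradedIdeal (J : TwoSidedIdeal (Hat F γ)) : Prop :=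
  ∀ x ∈ J, x ∈ AddSubgroup.closure {y : Hat F γ | y ∈ J ∧ ∃ i : ℤ, y ∈ hatComponent F γ i}

/-- An ideal is closed if it is closed in the topology of `L̂(Γ)`. -/
def IsClosedIdeal (J : TwoSidedIdeal (Hat F γ)) : Prop := IsClosed {x : Hat F γ | x ∈ J}

/-- An ideal is nilpotent if, for some `n`, all products of `n` of its elements vanish. -/
def IsNilpotentIdeal (J : TwoSidedIdeal (Hat F γ)) : Prop :=
  ∃ n : ℕ, ∀ l : List (Hat F γ), l.length = n → (∀ x ∈ l, x ∈ J) → l.prod = 0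

variable (F γ)

/-- The ideal `I(W)`: the smallest closed ideal of `L̂(Γ)` that contains all vertices in `W`. -/
def idealOf (W : Set V) : TwoSidedIdeal (Hat F γ) :=
  sInf {I | IsClosedIdeal I ∧ ∀ w ∈ W, toHat F γ (LPA.vtx F G w) ∈ I}

theorem isClosedIdeal_idealOf (W : Set V) : IsClosedIdeal (idealOf F γ W) := by
  have : {x : Hat F γ | x ∈ idealOf F γ W}
      = ⋂ I ∈ {I : TwoSidedIdeal (Hat F γ) | IsClosedIdeal I ∧
          ∀ w ∈ W, toHat F γ (LPA.vtx F G w) ∈ I}, {x | x ∈ I} := by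
    ext x
    simp only [idealOf, TwoSidedIdeal.mem_sInf, Set.mem_ofPred_eq, Set.mem_iInter]
  rw [IsClosedIdeal, this]
  exact isClosed_biInter fun I hI => hI.1

/-- The element `g_v(n) g_v(n)*` of `L̂(Γ)`. -/
def gProj (v : V) (n : ℕ) : Hat F γ := toHat F γ (LPA.mono F (γ.g v n) (γ.g v n))

/-- The element `e_v`, the limit of `g_v(n) g_v(n)*` for `n → ∞`. -/
def limIdem (v : V) : Hat F γ := limUnder atTop (gProj F γ v)

end LPA

end Leavitt

end

/-!
A nonzero graded ideal of `L̂(Γ)` contains one of the idempotents `e_v`; both claims follow from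
this.

The idempotents `e_v` behave like minimal ones. If `f` is an edge with source `v`, then `e_v f = 0`
unless `f = γ(v)`, and `e_v = γ(v) e_{r(γ(v))} γ(v)*`. Hence `e_u p q* e_w` vanishes unless `p` and
`q` consist of special edges, and then it equals `p e_t q*`, where `t` is the common range of `p`
and `q`. Special paths are determined by their source and length, and lengthening `p` and `q` by
the same special edges does not change `p e_t q*`; so the part of degree `i` of `e_u L̂(Γ) e_w` is
at most a line, spanned by some `p e_t q*` (`exists_span_corner`). Here one has to know that lines
of this kind are closed. This, as well as `e_v ≠ 0`, follows from a locally constant function on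
`L̂(Γ)` with the value `c` at `c e_v` (`exists_coeff_limIdem`). It is the extension of a matrix
coefficient of a representation of `L(Γ)` (`Branching.rep`), which vanishes on `V_1` because it
vanishes on `p q*` unless `p` and `q` are special.

On the other hand the elements `p e_{r(p)} p*` add up to `1`, in the sense that an open subgroup that
contains all of them contains `1` (`one_mem_of_isOpen`). So if `x ≠ 0`, then some
`e_{r(p)} p* x q e_{r(q)}` is not zero. For homogeneous `x` it lies on one of the lines above, and
therefore the ideal generated by `x` contains some `e_t` (`exists_limIdem_mem`).

As `e_t` is a nonzero idempotent, an ideal that contains it is not nilpotent. If `e_t ∈ I(W)`, then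
some special path `p` leads from `t` to `W`, since otherwise `e_t L̂(Γ) w = 0` for all `w ∈ W` and
`I(W)` would annihilate `e_t` (`exists_special_path_of_mem_idealOf`); and
`e_{r(p)} = p* e_t p` lies in every ideal that contains `e_t`.
-/

noncomputable section

namespace Leavitt

/-! ### Special paths -/

namespace Graph

variable {V E : Type*} {G : Graph V E}

theorem not_isSink_source (e : E) : ¬ G.IsSink (G.s e) := fun h => h e rfl

/-- The concatenation `p q` of two paths. -/
def Path.comp (p q : G.Path) (h : p.range = q.source) : G.Path :=
  ⟨p.source, p.edges ++ q.edges, q.range, p.isWalk.append (h ▸ q.isWalk)⟩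

theorem Path.nil_comp {v : V} (p : G.Path) (h : v = p.source) :
    (Path.nil v).comp p h = p := by
  subst h
  rfl

namespace Specialization

variable (γ : G.Specialization)

theorem isSpecial_iff {e : E} : γ.IsSpecial e ↔ e = γ.edge ⟨G.s e, not_isSink_source e⟩ := by
  constructor
  · rintro ⟨v, rfl⟩
    congr 1
    exact Subtype.ext (γ.source_edge v).symm
  · intro h
    exact ⟨_, h.symm⟩

theorem IsSpecial.eq_edge {γ : G.Specialization} {e : E} (h : γ.IsSpecial e) {v : V}
    (hv : ¬ G.IsSink v) (he : G.s e = v) : e = γ.edge ⟨v, hv⟩ := by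
  subst he
  exact γ.isSpecial_iff.1 h

theorem eq_of_isSpecial {e f : E} (he : γ.IsSpecial e) (hf : γ.IsSpecial f)
    (h : G.s e = G.s f) : e = f := by
  rw [γ.isSpecial_iff.1 hf]
  exact he.eq_edge _ h

/-- A path from a vertex along special edges is determined by its length; a shorter one is an
initial segment of a longer one. -/
theorem exists_append_of_special {u t₁ t₂ : V} {l₁ l₂ : List E} (h₁ : G.IsWalk u l₁ t₁)
    (h₂ : G.IsWalk u l₂ t₂) (s₁ : ∀ e ∈ l₁, γ.IsSpecial e) (s₂ : ∀ e ∈ l₂, γ.IsSpecial e)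
    (h : l₁.length ≤ l₂.length) :
    ∃ l, l₂ = l₁ ++ l ∧ G.IsWalk t₁ l t₂ ∧ ∀ e ∈ l, γ.IsSpecial e := by
  induction l₁ generalizing u l₂ with
  | nil => cases h₁; exact ⟨l₂, rfl, h₂, s₂⟩
  | cons e l₁ ih =>
    cases l₂ with
    | nil => simp at h
    | cons f l₂ =>
      obtain rfl : e = f := γ.eq_of_isSpecial (s₁ e (by simp)) (s₂ f (by simp))
        (h₁.1.trans h₂.1.symm)
      obtain ⟨l, rfl, hl⟩ := ih h₁.2 h₂.2 (fun x hx => s₁ x (by simp [hx]))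
        (fun x hx => s₂ x (by simp [hx])) (by simpa using h)
      exact ⟨l, rfl, hl⟩

theorem sd_eq_length {p : G.Path} (h : ∀ e ∈ p.edges, γ.IsSpecial e) : γ.sd p = p.length := by
  unfold sd Path.length
  rw [List.rtakeWhile_eq_self_iff.2]
  simpa using h

theorem sd_eq_zero_of_concat {p : G.Path} {l : List E} {e : E} (hp : p.edges = l ++ [e])
    (h : ¬ γ.IsSpecial e) : γ.sd p = 0 := by
  unfold sd
  rw [hp, List.rtakeWhile_concat]
  simp [h]

theorem g_source (v : V) (n : ℕ) : (γ.g v n).source = v := by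
  induction n with
  | zero => rfl
  | succ n ih =>
    rw [g]
    split
    · exact ih
    · exact ih

theorem g_special (v : V) (n : ℕ) : ∀ e ∈ (γ.g v n).edges, γ.IsSpecial e := by
  induction n with
  | zero => simp [g, Path.nil]
  | succ n ih =>
    rw [g]
    split
    · exact ih
    · intro e he
      simp only [Path.snoc, List.mem_append, List.mem_singleton] at he
      rcases he with he | rfl
      · exact ih e he
      · exact ⟨_, rfl⟩

theorem g_succ_of_isSink {v : V} {n : ℕ} (h : G.IsSink (γ.g v n).range) :
    γ.g v (n + 1) = γ.g v n := by
  rw [g, dif_pos h]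

theorem g_succ_of_not_isSink {v : V} {n : ℕ} (h : ¬ G.IsSink (γ.g v n).range) :
    γ.g v (n + 1) = (γ.g v n).snoc (γ.edge ⟨_, h⟩) (γ.source_edge ⟨_, h⟩) := by
  rw [g, dif_neg h]

theorem g_length {v : V} {n : ℕ} (h : ¬ G.IsSink (γ.g v n).range) : (γ.g v n).length = n := by
  induction n with
  | zero => rfl
  | succ n ih =>
    by_cases h' : G.IsSink (γ.g v n).range
    · rw [γ.g_succ_of_isSink h'] at h
      exact absurd h' h
    · rw [γ.g_succ_of_not_isSink h']
      simpa [Path.snoc, Path.length] using ih h'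

/-- `g_v(n+1)` also arises by prepending the special edge at `v` to `g_{r(γ(v))}(n)`. -/
theorem g_succ_cons {v : V} (h : ¬ G.IsSink v) (n : ℕ) :
    (γ.g v (n + 1)).edges = γ.edge ⟨v, h⟩ :: (γ.g (G.r (γ.edge ⟨v, h⟩)) n).edges ∧
    (γ.g v (n + 1)).range = (γ.g (G.r (γ.edge ⟨v, h⟩)) n).range := by
  induction n with
  | zero => rw [g_succ_of_not_isSink (h := h)]; exact ⟨rfl, rfl⟩
  | succ n ih =>
    by_cases h' : G.IsSink (γ.g v (n + 1)).range
    · rw [γ.g_succ_of_isSink h', γ.g_succ_of_isSink (ih.2.subst (motive := G.IsSink) h')]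
      exact ih
    · rw [γ.g_succ_of_not_isSink h',
        γ.g_succ_of_not_isSink (ih.2.subst (motive := fun w => ¬ G.IsSink w) h')]
      simp only [Path.snoc, ih.1, ih.2, List.cons_append, and_self]

end Specialization

end Graph

/-! ### A representation on functions, and the functional it defines -/

section Branching

variable {V E : Type*} [Fintype E] {G : Graph V E} (γ : G.Specialization)

/-- Over every vertex `v` that is not a sink, the pairs `(e, n)` with `s(e) = v` and `n : ℕ` are
in bijection with `ℕ`, in such a way that `(γ(v), 0)` corresponds to `0`. Here `c e n` is the
number of the pair `(e, n)`, and `h v m`, `t v m` are the components of the pair with number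
`m`. The values of `h` are in `Option E` because there is no edge to choose over a sink. -/
structure Branching where
  c : E → ℕ → ℕ
  h : V → ℕ → Option E
  t : V → ℕ → ℕ
  exists_edge : ∀ v m, ¬ G.IsSink v → ∃ e, h v m = some e ∧ G.s e = v ∧ c e (t v m) = m
  h_c : ∀ e n, h (G.s e) (c e n) = some e
  t_c : ∀ e n, t (G.s e) (c e n) = n
  h_zero : ∀ v (hv : ¬ G.IsSink v), h v 0 = some (γ.edge ⟨v, hv⟩)
  t_zero : ∀ v, ¬ G.IsSink v → t v 0 = 0

theorem exists_equiv_nat_edges (v : V) (hv : ¬ G.IsSink v) :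
    ∃ f : {e : E // G.s e = v} × ℕ ≃ ℕ, f (⟨γ.edge ⟨v, hv⟩, γ.source_edge _⟩, 0) = 0 := by
  have : Nonempty {e : E // G.s e = v} := ⟨⟨γ.edge ⟨v, hv⟩, γ.source_edge _⟩⟩
  obtain ⟨f⟩ : Nonempty ({e : E // G.s e = v} × ℕ ≃ ℕ) := by
    have : Countable {e : E // G.s e = v} := Finite.to_countable
    exact nonempty_equiv_of_countable
  exact ⟨f.trans (Equiv.swap (f (⟨γ.edge ⟨v, hv⟩, γ.source_edge _⟩, 0)) 0), by simp⟩

open Classical in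
theorem Branching.nonempty : Nonempty (Branching γ) := by
  choose f hf using exists_equiv_nat_edges γ
  exact ⟨{
    c := fun e n => f (G.s e) (Graph.not_isSink_source e) (⟨e, rfl⟩, n)
    h := fun v m => if hv : G.IsSink v then none else some ((f v hv).symm m).1.1
    t := fun v m => if hv : G.IsSink v then 0 else ((f v hv).symm m).2
    exists_edge := fun v m hv => by
      obtain ⟨⟨⟨e, rfl⟩, n⟩, rfl⟩ := (f v hv).surjective m
      exact ⟨e, by simp [hv], rfl, by simp [hv]⟩
    h_c := fun e n => by simp [Graph.not_isSink_source e]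
    t_c := fun e n => by simp [Graph.not_isSink_source e]
    h_zero := fun v hv => by
      have h := (f v hv).symm_apply_eq.2 (hf v hv).symm
      simp [hv, h]
    t_zero := fun v hv => by
      have h := (f v hv).symm_apply_eq.2 (hf v hv).symm
      simp [hv, h] }⟩

end Branching

section Rep

variable {V E : Type*} [Fintype V] [Fintype E] (F : Type*) [Field F] {G : Graph V E}
  {γ : G.Specialization} (B : Branching γ)

namespace Branching

open Classical in
/-- The action of the generators on functions on `V × ℕ`. A vertex restricts functions to its
fibre; an edge `e` moves the fibre over `r(e)` into the fibre over `s(e)`, and `e*` undoes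
this. -/
def act : Gen V E → Module.End F (V × ℕ → F)
  | .vtx v =>
    { toFun := fun f x => if x.1 = v then f x else 0
      map_add' := fun f g => by ext x; dsimp; split <;> simp
      map_smul' := fun a f => by ext x; dsimp; split <;> simp }
  | .edge e =>
    { toFun := fun f x => if x.1 = G.s e ∧ B.h x.1 x.2 = some e then f (G.r e, B.t x.1 x.2) else 0
      map_add' := fun f g => by ext x; dsimp; split <;> simp
      map_smul' := fun a f => by ext x; dsimp; split <;> simp }
  | .ghost e =>
    { toFun := fun f x => if x.1 = G.r e then f (G.s e, B.c e x.2) else 0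
      map_add' := fun f g => by ext x; dsimp; split <;> simp
      map_smul' := fun a f => by ext x; dsimp; split <;> simp }

open Classical in
/-- The representation of the Leavitt path algebra on functions on `V × ℕ`. -/
def rep : LPA F G →ₐ[F] Module.End F (V × ℕ → F) :=
  RingQuot.liftAlgHom F ⟨FreeAlgebra.lift F (B.act F), by
    intro x y hxy
    induction hxy with
    | one =>
      ext f x
      simp [act]
    | vtx_self v => ext f x; by_cases h : x.1 = v <;> simp [act, h]
    | vtx_ne v w hvw => ext f x; by_cases h : x.1 = v <;> simp [act, h, hvw]
    | source_edge e => ext f x; by_cases h : x.1 = G.s e <;> simp [act, h]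
    | edge_range e => ext f x; simp [act]
    | range_ghost e => ext f x; by_cases h : x.1 = G.r e <;> simp [act, h]
    | ghost_source e => ext f x; simp [act]
    | ghost_edge_self e =>
      ext f ⟨v, n⟩
      by_cases h : v = G.r e
      · simp [act, h, B.h_c, B.t_c]
      · simp [act, h]
    | ghost_edge_ne e e' hee =>
      ext f ⟨v, n⟩
      by_cases h : G.s e = G.s e'
      · have := B.h_c e n
        simp [act, ← h, B.h_c, hee]
      · simp [act, h]
    | sum_edge_ghost v hv =>
      ext f ⟨w, n⟩
      by_cases h : w = v
      · subst h
        simp only [map_sum, map_mul, FreeAlgebra.lift_ι_apply, LinearMap.coe_sum, Finset.sum_apply,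
          Module.End.mul_apply, act, LinearMap.coe_mk, AddHom.coe_mk, if_true]
        obtain ⟨e₀, h1, h2, h3⟩ := B.exists_edge w n hv
        rw [Finset.sum_eq_single e₀]
        · simp [h1, h2, h3]
        · intro e _ he
          rw [if_neg]
          rintro ⟨-, h⟩
          exact he (Option.some.inj (h.symm.trans h1))
        · intro he
          simp [h2] at he
      · simp only [map_sum, map_mul, FreeAlgebra.lift_ι_apply, LinearMap.coe_sum, Finset.sum_apply,
          Module.End.mul_apply, act, LinearMap.coe_mk, AddHom.coe_mk, if_neg h]
        refine Finset.sum_eq_zero fun e he => ?_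
        rw [if_neg]
        rintro ⟨h', -⟩
        exact h (h'.trans (Finset.mem_filter.1 he).2)⟩

theorem rep_of (x : Gen V E) : B.rep F (LPA.of F x) = B.act F x := by
  rw [rep, LPA.of]
  erw [RingQuot.liftAlgHom_mkAlgHom_apply]
  simp

open Classical in
theorem rep_vtx_apply (v : V) (f : V × ℕ → F) (x : V × ℕ) :
    B.rep F (LPA.vtx F G v) f x = if x.1 = v then f x else 0 := by
  rw [LPA.vtx, rep_of]; rfl

open Classical in
theorem rep_edge_apply_zero (e : E) (f : V × ℕ → F) :
    B.rep F (LPA.edge F G e) f (G.s e, 0) = if γ.IsSpecial e then f (G.r e, 0) else 0 := by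
  rw [LPA.edge, rep_of]
  have hs := Graph.not_isSink_source (G := G) e
  change (if G.s e = G.s e ∧ B.h (G.s e) 0 = some e then f (G.r e, B.t (G.s e) 0) else 0) = _
  rw [B.h_zero _ hs, B.t_zero _ hs, γ.isSpecial_iff]
  simp [eq_comm]

open Classical in
theorem rep_ghost_single (e : E) :
    B.rep F (LPA.ghost F G e) (Pi.single (G.s e, 0) 1)
      = if γ.IsSpecial e then Pi.single (G.r e, 0) 1 else 0 := by
  rw [LPA.ghost, rep_of]
  have hs := Graph.not_isSink_source (G := G) e
  have key : ∀ n, B.c e n = 0 ↔ γ.IsSpecial e ∧ n = 0 := by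
    intro n
    constructor
    · intro h
      have h1 := B.h_c e n
      have h2 := B.t_c e n
      rw [h, B.h_zero _ hs] at h1
      rw [h, B.t_zero _ hs] at h2
      exact ⟨γ.isSpecial_iff.2 (Option.some.inj h1).symm, h2.symm⟩
    · rintro ⟨h, rfl⟩
      obtain ⟨e', h1, -, h2⟩ := B.exists_edge (G.s e) 0 hs
      rw [B.h_zero _ hs, ← γ.isSpecial_iff.1 h] at h1
      rwa [B.t_zero _ hs, ← Option.some.inj h1] at h2
  ext ⟨v, n⟩
  change (if v = G.r e then (Pi.single (G.s e, 0) 1 : V × ℕ → F) (G.s e, B.c e n) else 0) = _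
  simp only [Pi.single_apply, Prod.mk.injEq, true_and, key]
  by_cases h : γ.IsSpecial e
  · by_cases hv : v = G.r e <;> simp [h, hv, Pi.single_apply]
  · simp [h]

open Classical in
theorem rep_walk_apply_zero {u t : V} {l : List E} (h : G.IsWalk u l t) (f : V × ℕ → F) :
    B.rep F (LPA.vtx F G u * (l.map (LPA.edge F G)).prod) f (u, 0)
      = if ∀ e ∈ l, γ.IsSpecial e then f (t, 0) else 0 := by
  induction l generalizing u with
  | nil => cases h; simp [rep_vtx_apply]
  | cons e l ih =>
    obtain ⟨rfl, h⟩ := h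
    rw [LPA.walk_cons rfl, map_mul, Module.End.mul_apply, rep_edge_apply_zero, ih h]
    by_cases he : γ.IsSpecial e <;> simp [he]

open Classical in
theorem rep_ghostWalk_single {u t : V} {l : List E} (h : G.IsWalk u l t) :
    B.rep F ((l.map (LPA.ghost F G)).reverse.prod * LPA.vtx F G u) (Pi.single (u, 0) 1)
      = if ∀ e ∈ l, γ.IsSpecial e then Pi.single (t, 0) 1 else 0 := by
  induction l generalizing u with
  | nil =>
    cases h
    ext x
    by_cases hx : x = (t, 0)
    · simp [rep_vtx_apply, hx]
    · simp [rep_vtx_apply, Pi.single_eq_of_ne hx]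
  | cons e l ih =>
    obtain ⟨rfl, h⟩ := h
    rw [LPA.ghostWalk_cons rfl, map_mul, Module.End.mul_apply, rep_ghost_single]
    by_cases he : γ.IsSpecial e
    · simp only [he, if_true, ih h]
      simp [he]
    · simp [he]

open Classical in
/-- The matrix coefficient of the representation at the point `(u, 0)`, which stands for the
sequence of special edges from `u` on. -/
def coeff (u : V) : LPA F G →ₗ[F] F where
  toFun a := B.rep F a (Pi.single (u, 0) 1) (u, 0)
  map_add' a b := by simp
  map_smul' c a := by simp

open Classical in
theorem coeff_mono_self {p : G.Path} (hp : ∀ e ∈ p.edges, γ.IsSpecial e) :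
    B.coeff F p.source (LPA.mono F p p) = 1 := by
  change B.rep F (LPA.mono F p p) (Pi.single (p.source, 0) 1) (p.source, 0) = 1
  rw [LPA.mono, map_mul, Module.End.mul_apply, LPA.pathStar, rep_ghostWalk_single F B p.isWalk,
    LPA.path, rep_walk_apply_zero F B p.isWalk, if_pos hp, if_pos hp, Pi.single_eq_same]

open Classical in
theorem coeff_mono_eq_zero (u : V) {p q : G.Path}
    (h : ¬ ((∀ e ∈ p.edges, γ.IsSpecial e) ∧ ∀ e ∈ q.edges, γ.IsSpecial e)) :
    B.coeff F u (LPA.mono F p q) = 0 := by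
  change B.rep F (LPA.mono F p q) (Pi.single (u, 0) 1) (u, 0) = 0
  rw [LPA.mono, map_mul, Module.End.mul_apply]
  by_cases hq : q.source = u
  · subst hq
    rw [LPA.pathStar, rep_ghostWalk_single F B q.isWalk]
    by_cases hq' : ∀ e ∈ q.edges, γ.IsSpecial e
    · rw [if_pos hq']
      by_cases hp : p.source = q.source
      · rw [← hp, LPA.path, rep_walk_apply_zero F B p.isWalk, if_neg]
        exact fun hp => h ⟨hp, hq'⟩
      · rw [LPA.path, map_mul, Module.End.mul_apply, rep_vtx_apply, if_neg (Ne.symm hp)]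
    · rw [if_neg hq', map_zero, Pi.zero_apply]
  · have : B.rep F (LPA.vtx F G q.source) (Pi.single (u, 0) 1) = 0 := by
      ext x
      rw [rep_vtx_apply]
      by_cases hx : x = (u, 0)
      · subst hx
        simp [Ne.symm hq]
      · simp [hx]
    rw [LPA.pathStar, map_mul, Module.End.mul_apply, this, map_zero, map_zero, Pi.zero_apply]

/-- For special `p` and `q` the length `l(p) + l(q)` equals `sd(p) + sd(q)`, so that `p q*` is
none of the generators of `V_1`. -/
theorem coeff_eq_zero_of_mem (u : V) {a : LPA F G} (ha : a ∈ LPA.subspaceK F γ 1) :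
    B.coeff F u a = 0 := by
  rw [LPA.subspaceK_eq_span] at ha
  refine (Submodule.span_le (p := LinearMap.ker (B.coeff F u))).2 ?_ ha
  rintro _ ⟨p, q, -, h, rfl⟩
  refine B.coeff_mono_eq_zero F u ?_
  rintro ⟨hp, hq⟩
  rw [γ.sd_eq_length hp, γ.sd_eq_length hq] at h
  have := abs_nonneg ((p.length : ℝ) - q.length)
  push_cast at h
  linarith

end Branching

end Rep

/-! ### Closed subspaces and open subgroups of `L̂(Γ)` -/

section Topology

variable {V E : Type*} [Fintype V] [Fintype E] {F : Type*} [Field F] {G : Graph V E}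
  {γ : G.Specialization}

instance : IsTopologicalRing (Hat F γ) := inferInstanceAs (IsTopologicalRing (Hat F γ).toSubring)

theorem continuous_smul_hat (c : F) : Continuous fun x : Hat F γ => c • x := by
  simp_rw [Algebra.smul_def]
  exact continuous_const_mul _

theorem continuous_mul_mul (a b : Hat F γ) : Continuous fun x : Hat F γ => a * x * b :=
  (continuous_const_mul a).mul_const b

theorem continuous_toHat : Continuous (fun a : TopLPA F γ => toHat F γ a) :=
  Continuous.subtype_mk (UniformSpace.Completion.continuous_coe _) _

/-- An open additive subgroup of `L̂(Γ)` contains the image of some `V_k`. -/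
theorem exists_subspaceK_le {A : AddSubgroup (Hat F γ)} (hA : IsOpen (A : Set (Hat F γ))) :
    ∃ k, ∀ a ∈ LPA.subspaceK F γ k, toHat F γ a ∈ A := by
  have h : (fun a : TopLPA F γ => toHat F γ a) ⁻¹' A ∈ 𝓝 (0 : TopLPA F γ) := by
    refine (hA.preimage continuous_toHat).mem_nhds ?_
    change toHat F γ 0 ∈ A
    rw [map_zero]
    exact A.zero_mem
  obtain ⟨k, -, hk⟩ := (LPA.ringSubgroupsBasis F γ).hasBasis_nhds_zero.mem_iff.1 h
  exact ⟨k + 1, fun a ha => hk ha⟩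

/-- An element of `L̂(Γ)` that lies in all open additive subgroups is zero. -/
theorem eq_zero_of_mem_open {x : Hat F γ}
    (h : ∀ A : AddSubgroup (Hat F γ), IsOpen (A : Set (Hat F γ)) → x ∈ A) : x = 0 := by
  have : NonarchimedeanRing (TopLPA F γ) := (LPA.ringSubgroupsBasis F γ).nonarchimedean
  by_contra hx
  have hx' : (x : FullCompletion F γ) ≠ 0 := fun h0 => hx (Subtype.ext h0)
  obtain ⟨A, hA⟩ := NonarchimedeanAddGroup.is_nonarchimedean
    ({(x : FullCompletion F γ)}ᶜ : Set (FullCompletion F γ))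
    (isOpen_compl_singleton.mem_nhds (by simpa using hx'.symm))
  have := h ((A : AddSubgroup (FullCompletion F γ)).comap
    (Hat F γ).val.toRingHom.toAddMonoidHom) (A.isOpen.preimage continuous_subtype_val)
  exact hA this rfl

theorem hatComponent_subset_closure {i : ℤ} {x : Hat F γ} (hx : x ∈ hatComponent F γ i) :
    x ∈ closure (toHat F γ '' LPA.component F G i) := by
  rw [closure_subtype]
  refine closure_mono ?_ hx
  rintro _ ⟨a, ha, rfl⟩
  exact ⟨toHat F γ a, ⟨a, ha, rfl⟩, rfl⟩

/-- A closed subspace that contains all `p q*` of degree `i` contains all homogeneous elements of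
degree `i`. -/
theorem hatComponent_le {i : ℤ} {S : Submodule F (Hat F γ)} (hS : IsClosed (S : Set (Hat F γ)))
    (h : ∀ p q : G.Path, p.range = q.range → (p.length : ℤ) - q.length = i →
      toHat F γ (LPA.mono F p q) ∈ S) : hatComponent F γ i ≤ S := by
  intro x hx
  refine closure_minimal ?_ hS (hatComponent_subset_closure hx)
  rintro _ ⟨a, ha, rfl⟩
  refine (Submodule.span_le (p := S.comap (toHat F γ).toLinearMap)).2 ?_ ha
  rintro _ ⟨p, q, hr, hd, rfl⟩
  exact h p q hr hd

/-- As a sum of its homogeneous components, `L̂(Γ)` is generated by homogeneous elements. -/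
theorem hat_induction {P : Hat F γ → Prop} (add : ∀ x y, P x → P y → P (x + y))
    (mem : ∀ i, ∀ x ∈ hatComponent F γ i, P x) (x : Hat F γ) : P x := by
  obtain ⟨x, hx⟩ := x
  change x ∈ ⨆ i : ℤ, fullComponent F γ i at hx
  induction hx using Submodule.iSup_induction' with
  | zero => exact mem 0 _ (zero_mem _)
  | add a b ha hb iha ihb => exact add _ _ iha ihb
  | mem i x hx => exact mem i _ hx

/-- A closed subspace that contains all `p q*` is everything. -/
theorem eq_top_of_mono_mem {S : Submodule F (Hat F γ)} (hS : IsClosed (S : Set (Hat F γ)))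
    (h : ∀ p q : G.Path, p.range = q.range → toHat F γ (LPA.mono F p q) ∈ S) : S = ⊤ :=
  Submodule.eq_top_iff'.2 <| hat_induction (fun _ _ => S.add_mem) fun _ _ hx =>
    hatComponent_le hS (fun p q hr _ => h p q hr) hx

/-- The functional `coeff` extends to `L̂(Γ)`: it vanishes on `V_1`, so it is locally constant. -/
theorem exists_extend_coeff (B : Branching γ) (u : V) :
    ∃ φ : Hat F γ → F, IsLocallyConstant φ ∧ ∀ a, φ (toHat F γ a) = B.coeff F u a := by
  -- With the discrete uniformity `F` is complete, and continuity means local constancy.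
  let _ : UniformSpace F := ⊥
  have : DiscreteUniformity F := ⟨rfl⟩
  let f : TopLPA F γ →+ F := (B.coeff F u).toAddMonoidHom
  have hf : Continuous f := by
    refine continuous_of_continuousAt_zero f ?_
    rw [ContinuousAt, map_zero, nhds_discrete F, tendsto_pure]
    filter_upwards [(LPA.ringSubgroupsBasis F γ).hasBasis_nhds_zero.mem_of_mem (i := 0) trivial]
      with a ha
    exact B.coeff_eq_zero_of_mem F u ha
  refine ⟨fun x => f.extension hf x, ?_, fun a => ?_⟩
  · exact (IsLocallyConstant.iff_continuous _).2
      ((f.continuous_extension hf).comp continuous_subtype_val)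
  · exact f.extension_coe hf a

end Topology

/-! ### The idempotents `e_v` -/

section Idempotents

variable {V E : Type*} [Fintype V] [Fintype E] {F : Type*} [Field F] {G : Graph V E}
  (γ : G.Specialization)

namespace LPA

theorem mono_self_eq (p : G.Path) : mono F p p = path F p * vtx F G p.range * pathStar F p := by
  have h := walk_append (F := F) (l' := []) p.isWalk
  simp only [List.map_nil, List.prod_nil, mul_one, List.append_nil] at h
  rw [path, h, mono, path]

theorem path_snoc (p : G.Path) (e : E) (he : G.s e = p.range) :
    path F (p.snoc e he) = path F p * edge F G e := by
  simp [path, Graph.Path.snoc, mul_assoc]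

theorem pathStar_snoc (p : G.Path) (e : E) (he : G.s e = p.range) :
    pathStar F (p.snoc e he) = ghost F G e * pathStar F p := by
  simp [pathStar, Graph.Path.snoc, mul_assoc]

theorem pathStar_mul_path (p : G.Path) : pathStar F p * path F p = vtx F G p.range := by
  rcases p with ⟨u, l, t, h⟩
  simp only [pathStar, path]
  induction l generalizing u with
  | nil => cases h; simp [vtx_mul_self]
  | cons e l ih =>
    rw [walk_cons h.1, ghostWalk_cons h.1, mul_assoc, ← mul_assoc (ghost F G e),
      ghost_mul_edge_self, ← mul_assoc (vtx F G (G.r e)) (vtx F G (G.r e)), vtx_mul_self]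
    exact ih _ h.2

end LPA
open Classical in
/-- The relation at `r(p)`, multiplied by `p` and `p*`. -/
theorem LPA.mono_self_eq_sum (p : G.Path) (h : ¬ G.IsSink p.range) :
    mono F p p = ∑ e : {e : E // G.s e = p.range}, mono F (p.snoc e e.2) (p.snoc e e.2) := by
  have h0 := RingQuot.mkAlgHom_rel F (Rel.sum_edge_ghost (F := F) (G := G) _ h)
  simp only [map_sum, map_mul] at h0
  rw [mono_self_eq]
  have h1 : vtx F G p.range = ∑ e with G.s e = p.range, edge F G e * ghost F G e := h0.symm
  rw [h1, Finset.mul_sum, Finset.sum_mul, Finset.sum_subtype (p := fun e => G.s e = p.range) _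
    (by simp)]
  refine Finset.sum_congr rfl fun e _ => ?_
  rw [mono, path_snoc, pathStar_snoc]
  simp only [mul_assoc]

theorem LPA.path_comp (p q : G.Path) (h : p.range = q.source) :
    path F (p.comp q h) = path F p * path F q := by
  have := walk_append (F := F) (l' := q.edges) p.isWalk
  rw [path, path, path, ← h, this]
  rfl

theorem LPA.pathStar_comp (p q : G.Path) (h : p.range = q.source) :
    pathStar F (p.comp q h) = pathStar F q * pathStar F p := by
  have := ghostWalk_append (F := F) (l' := q.edges) p.isWalk
  rw [pathStar, pathStar, pathStar, ← h, this]
  rfl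

/-- The step from `q g(n) (q g(n))*` to `q g(n+1) (q g(n+1))*`, where `g(n) = g_{r(q)}(n)`, only
involves terms `q' q'*` where `q'` is longer than `q` and `g(n)` and does not end on a special
edge. -/
theorem LPA.mono_comp_g_sub_mem (q : G.Path) (A : AddSubgroup (LPA F G)) (n : ℕ)
    (hA : ∀ q' : G.Path, γ.sd q' = 0 → q.length + n < q'.length → mono F q' q' ∈ A) :
    mono F (q.comp (γ.g q.range n) (γ.g_source _ n).symm)
        (q.comp (γ.g q.range n) (γ.g_source _ n).symm)
      - mono F (q.comp (γ.g q.range (n + 1)) (γ.g_source _ _).symm)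
        (q.comp (γ.g q.range (n + 1)) (γ.g_source _ _).symm) ∈ A := by
  classical
  by_cases h : G.IsSink (γ.g q.range n).range
  · simp only [γ.g_succ_of_isSink h, sub_self]
    exact A.zero_mem
  -- Expand at the range of `q g(n)`; the summand of the special edge is the next term.
  · rw [LPA.mono_self_eq_sum _ (by exact h),
      ← Finset.add_sum_erase _ _ (Finset.mem_univ ⟨γ.edge ⟨_, h⟩, γ.source_edge _⟩)]
    have hs : q.comp (γ.g q.range (n + 1)) (γ.g_source _ _).symm
        = (q.comp (γ.g q.range n) (γ.g_source _ n).symm).snoc (γ.edge ⟨_, h⟩)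
          (γ.source_edge ⟨_, h⟩) := by
      simp only [γ.g_succ_of_not_isSink h]
      simp [Graph.Path.comp, Graph.Path.snoc]
    rw [← hs, add_sub_cancel_left]
    refine sum_mem fun e he => hA _ ?_ ?_
    · refine γ.sd_eq_zero_of_concat (l := (q.comp (γ.g q.range n) (γ.g_source _ n).symm).edges)
        rfl fun hsp => (Finset.mem_erase.1 he).1 (Subtype.ext (hsp.eq_edge h e.2))
    · have hl := γ.g_length h
      simp only [Graph.Path.length] at hl
      simp [Graph.Path.snoc, Graph.Path.comp, Graph.Path.length, hl]

/-- `q q*` has `d = 0`, and `s = 0` if `q` does not end on a special edge. -/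
theorem mono_self_mem_subspaceK {k : ℕ} {q : G.Path} (hq : γ.sd q = 0) (hk : k ≤ q.length) :
    LPA.mono F q q ∈ LPA.subspaceK F γ k := by
  rw [LPA.subspaceK_eq_span]
  refine Submodule.subset_span ⟨q, q, rfl, ?_, rfl⟩
  have : (k : ℝ) ≤ q.length := by exact_mod_cast hk
  simp only [hq, sub_self, abs_zero]
  push_cast
  nlinarith [Nat.cast_nonneg (α := ℝ) q.length]

theorem gProj_sub_mem (v : V) (k m n : ℕ) (hm : k ≤ m) (hn : k ≤ n) :
    LPA.mono F (γ.g v m) (γ.g v m) - LPA.mono F (γ.g v n) (γ.g v n) ∈ LPA.subspaceK F γ k := by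
  have key : ∀ n, k ≤ n → LPA.mono F (γ.g v k) (γ.g v k) - LPA.mono F (γ.g v n) (γ.g v n)
      ∈ LPA.subspaceK F γ k := by
    intro n hn
    induction n, hn using Nat.le_induction with
    | base => rw [sub_self]; exact zero_mem _
    | succ n hn ih =>
      have := LPA.mono_comp_g_sub_mem γ (Graph.Path.nil v)
        (LPA.subspaceK F γ k).toAddSubgroup n
        (fun q' h1 h2 => mono_self_mem_subspaceK γ h1 (by omega))
      have e : ∀ n h, (Graph.Path.nil v).comp (γ.g (Graph.Path.nil (G := G) v).range n) h
          = γ.g v n := fun n h => Graph.Path.nil_comp _ h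
      rw [e, e] at this
      simpa using add_mem ih this
  have h := sub_mem (key n hn) (key m hm)
  simpa using h

/-- The limit `e_v` exists, so that `limIdem` is not a junk value. -/
theorem tendsto_gProj (v : V) :
    Tendsto (gProj F γ v) atTop (𝓝 (limIdem F γ v)) := by
  refine tendsto_nhds_limUnder ?_
  have hc : CauchySeq fun n => (toFull F γ (LPA.mono F (γ.g v n) (γ.g v n))) := by
    have h0 : CauchySeq (β := ℕ) (α := TopLPA F γ) fun n => LPA.mono F (γ.g v n) (γ.g v n) := by
      have hb := ((LPA.ringSubgroupsBasis F γ).hasBasis_nhds_zero).comap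
        (fun x : TopLPA F γ × TopLPA F γ => x.2 - x.1)
      replace hb := (uniformity_eq_comap_nhds_zero (TopLPA F γ)).symm ▸ hb
      exact hb.cauchySeq_iff.2 fun k _ => ⟨k + 1, fun m hm n hn =>
        gProj_sub_mem γ v (k + 1) n m hn hm⟩
    exact h0.map (UniformSpace.Completion.uniformContinuous_coe _)
  obtain ⟨y, hy⟩ := cauchySeq_tendsto_of_complete hc
  have hy0 : y ∈ fullComponent F γ 0 := by
    refine mem_closure_of_tendsto hy (Eventually.of_forall fun n => ?_)
    exact ⟨_, Submodule.subset_span ⟨_, _, rfl, sub_self _, rfl⟩, rfl⟩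
  refine ⟨⟨y, Submodule.mem_iSup_of_mem 0 hy0⟩, ?_⟩
  rw [tendsto_subtype_rng]
  exact hy

variable {γ}

local notation "ι" => toHat F γ
local notation "ε" => limIdem F γ

theorem gProj_mul_self (v : V) (n : ℕ) : gProj F γ v n * gProj F γ v n = gProj F γ v n := by
  rw [gProj, ← map_mul]
  nth_rewrite 2 [LPA.mono]
  rw [LPA.mono, mul_assoc, ← mul_assoc (LPA.pathStar F _), LPA.pathStar_mul_path, ← mul_assoc,
    ← LPA.mono_self_eq, LPA.mono]

theorem vtx_mul_gProj (v : V) (n : ℕ) : ι (LPA.vtx F G v) * gProj F γ v n = gProj F γ v n := by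
  rw [gProj, ← map_mul, LPA.mono, LPA.path, γ.g_source, ← mul_assoc, ← mul_assoc, LPA.vtx_mul_self]

theorem gProj_mul_vtx (v : V) (n : ℕ) : gProj F γ v n * ι (LPA.vtx F G v) = gProj F γ v n := by
  rw [gProj, ← map_mul, LPA.mono, LPA.pathStar, γ.g_source, mul_assoc, mul_assoc, LPA.vtx_mul_self]

theorem gProj_succ {v : V} (h : ¬ G.IsSink v) (n : ℕ) :
    gProj F γ v (n + 1) = ι (LPA.edge F G (γ.edge ⟨v, h⟩))
      * gProj F γ (G.r (γ.edge ⟨v, h⟩)) n * ι (LPA.ghost F G (γ.edge ⟨v, h⟩)) := by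
  rw [gProj, gProj, ← map_mul, ← map_mul, LPA.mono, LPA.mono, LPA.path, LPA.pathStar, LPA.path,
    LPA.pathStar, γ.g_source, γ.g_source, (γ.g_succ_cons h n).1, LPA.walk_cons (γ.source_edge ⟨v, h⟩),
    LPA.ghostWalk_cons (γ.source_edge ⟨v, h⟩)]
  simp only [mul_assoc]

theorem limIdem_mul_self (v : V) : ε v * ε v = ε v := by
  refine tendsto_nhds_unique ((tendsto_gProj γ v).mul (tendsto_gProj γ v)) ?_
  simpa only [gProj_mul_self] using tendsto_gProj (F := F) γ v

theorem vtx_mul_limIdem (v : V) : ι (LPA.vtx F G v) * ε v = ε v := by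
  refine tendsto_nhds_unique ((tendsto_gProj γ v).const_mul _) ?_
  simpa only [vtx_mul_gProj] using tendsto_gProj (F := F) γ v

theorem limIdem_mul_vtx (v : V) : ε v * ι (LPA.vtx F G v) = ε v := by
  refine tendsto_nhds_unique ((tendsto_gProj γ v).mul_const _) ?_
  simpa only [gProj_mul_vtx] using tendsto_gProj (F := F) γ v

theorem limIdem_eq_edge_mul {v : V} (h : ¬ G.IsSink v) :
    ε v = ι (LPA.edge F G (γ.edge ⟨v, h⟩))
      * ε (G.r (γ.edge ⟨v, h⟩)) * ι (LPA.ghost F G (γ.edge ⟨v, h⟩)) := by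
  refine tendsto_nhds_unique ((tendsto_gProj γ v).comp (tendsto_add_atTop_nat 1)) ?_
  refine (((continuous_mul_mul _ _).tendsto _).comp (tendsto_gProj γ _)).congr fun n => ?_
  exact (gProj_succ h n).symm

theorem limIdem_mul_vtx_ne {v w : V} (h : v ≠ w) : ε v * ι (LPA.vtx F G w) = 0 := by
  rw [← limIdem_mul_vtx, mul_assoc, ← map_mul, LPA.vtx_mul_ne h, map_zero, mul_zero]

theorem vtx_mul_limIdem_ne {v w : V} (h : w ≠ v) : ι (LPA.vtx F G w) * ε v = 0 := by
  rw [← vtx_mul_limIdem, ← mul_assoc, ← map_mul, LPA.vtx_mul_ne h, map_zero, zero_mul]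

theorem limIdem_mul_edge {e : E} (h : ¬ γ.IsSpecial e) : ε (G.s e) * ι (LPA.edge F G e) = 0 := by
  rw [limIdem_eq_edge_mul (Graph.not_isSink_source e), mul_assoc, ← map_mul,
    LPA.ghost_mul_edge_ne, map_zero, mul_zero]
  exact fun h' => h (γ.isSpecial_iff.2 h'.symm)

theorem ghost_mul_limIdem {e : E} (h : ¬ γ.IsSpecial e) : ι (LPA.ghost F G e) * ε (G.s e) = 0 := by
  rw [limIdem_eq_edge_mul (Graph.not_isSink_source e), mul_assoc, ← mul_assoc, ← map_mul,
    LPA.ghost_mul_edge_ne, map_zero, zero_mul]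
  exact fun h' => h (γ.isSpecial_iff.2 h')

/-- A path along special edges conjugates the idempotent at its range into that at its source. -/
theorem limIdem_eq_path_mul (p : G.Path) (hp : ∀ e ∈ p.edges, γ.IsSpecial e) :
    ε p.source = ι (LPA.path F p) * ε p.range * ι (LPA.pathStar F p) := by
  rcases p with ⟨u, l, t, h⟩
  simp only [LPA.pathStar, LPA.path] at *
  induction l generalizing u with
  | nil => cases h; simp [vtx_mul_limIdem, limIdem_mul_vtx]
  | cons e l ih =>
    obtain ⟨rfl, h⟩ := h
    have he : e = γ.edge ⟨_, Graph.not_isSink_source e⟩ := γ.isSpecial_iff.1 (hp e (by simp))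
    have h1 := limIdem_eq_edge_mul (F := F) (γ := γ) (Graph.not_isSink_source e)
    rw [← he, ih _ h (fun x hx => hp x (by simp [hx]))] at h1
    rw [LPA.walk_cons rfl, LPA.ghostWalk_cons rfl, h1]
    simp only [map_mul, mul_assoc]

theorem limIdem_mul_path {p : G.Path} (hp : ∀ e ∈ p.edges, γ.IsSpecial e) :
    ε p.source * ι (LPA.path F p) = ι (LPA.path F p) * ε p.range := by
  rw [limIdem_eq_path_mul p hp, mul_assoc, ← map_mul, LPA.pathStar_mul_path, mul_assoc,
    limIdem_mul_vtx]

theorem pathStar_mul_limIdem {p : G.Path} (hp : ∀ e ∈ p.edges, γ.IsSpecial e) :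
    ι (LPA.pathStar F p) * ε p.source = ε p.range * ι (LPA.pathStar F p) := by
  rw [limIdem_eq_path_mul p hp, ← mul_assoc, ← mul_assoc, ← map_mul, LPA.pathStar_mul_path,
    vtx_mul_limIdem]

theorem pathStar_mul_limIdem_mul_path {p : G.Path} (hp : ∀ e ∈ p.edges, γ.IsSpecial e) :
    ι (LPA.pathStar F p) * ε p.source * ι (LPA.path F p) = ε p.range := by
  rw [pathStar_mul_limIdem hp, mul_assoc, ← map_mul, LPA.pathStar_mul_path, limIdem_mul_vtx]

theorem limIdem_mul_path_eq_zero {u : V} {p : G.Path}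
    (hp : ¬ (p.source = u ∧ ∀ e ∈ p.edges, γ.IsSpecial e)) : ε u * ι (LPA.path F p) = 0 := by
  by_cases hu : u = p.source
  swap
  · rw [LPA.path, map_mul, ← mul_assoc, limIdem_mul_vtx_ne hu, zero_mul]
  subst hu
  replace hp : ¬ ∀ e ∈ p.edges, γ.IsSpecial e := fun h => hp ⟨rfl, h⟩
  rcases p with ⟨u, l, t, h⟩
  simp only [LPA.path] at *
  induction l generalizing u with
  | nil => simp at hp
  | cons e l ih =>
    obtain ⟨rfl, h⟩ := h
    rw [LPA.walk_cons rfl, map_mul, ← mul_assoc]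
    by_cases he : γ.IsSpecial e
    · have h1 := limIdem_mul_path (F := F) (γ := γ) (p := ⟨G.s e, [e], G.r e, rfl, rfl⟩)
        (by simpa using he)
      simp only [LPA.path, List.map_cons, List.map_nil, List.prod_singleton,
        LPA.source_mul_edge] at h1
      rw [h1, mul_assoc, ih _ h, mul_zero]
      intro h'
      exact hp (by simpa [he] using h')
    · rw [limIdem_mul_edge he, zero_mul]

theorem pathStar_mul_limIdem_eq_zero {u : V} {p : G.Path}
    (hp : ¬ (p.source = u ∧ ∀ e ∈ p.edges, γ.IsSpecial e)) : ι (LPA.pathStar F p) * ε u = 0 := by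
  by_cases hu : p.source = u
  swap
  · rw [LPA.pathStar, map_mul, mul_assoc, vtx_mul_limIdem_ne hu, mul_zero]
  subst hu
  replace hp : ¬ ∀ e ∈ p.edges, γ.IsSpecial e := fun h => hp ⟨rfl, h⟩
  rcases p with ⟨u, l, t, h⟩
  simp only [LPA.pathStar] at *
  induction l generalizing u with
  | nil => simp at hp
  | cons e l ih =>
    obtain ⟨rfl, h⟩ := h
    rw [LPA.ghostWalk_cons rfl, map_mul, mul_assoc]
    by_cases he : γ.IsSpecial e
    · have h1 := pathStar_mul_limIdem (F := F) (γ := γ) (p := ⟨G.s e, [e], G.r e, rfl, rfl⟩)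
        (by simpa using he)
      simp only [LPA.pathStar, List.map_cons, List.map_nil, List.reverse_singleton,
        List.prod_singleton, LPA.ghost_mul_source] at h1
      rw [h1, ← mul_assoc, ih _ h, zero_mul]
      intro h'
      exact hp (by simpa [he] using h')
    · rw [ghost_mul_limIdem he, mul_zero]

/-! ### Locally constant functionals, and closed lines -/

/-- A locally constant function that reads off the coefficient of `e_v` from a multiple of
`e_v`. -/
theorem exists_coeff_limIdem (v : V) :
    ∃ φ : Hat F γ → F, IsLocallyConstant φ ∧ ∀ c : F, φ (c • ε v) = c := by
  obtain ⟨B⟩ := Branching.nonempty γ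
  obtain ⟨φ, hφ, h⟩ := exists_extend_coeff (F := F) B v
  refine ⟨φ, hφ, fun c => ?_⟩
  have h1 := ((continuous_smul_hat c).tendsto _).comp (tendsto_gProj (F := F) γ v)
  obtain ⟨n, hn⟩ := (h1.eventually ((hφ.isOpen_fiber (φ (c • ε v))).mem_nhds rfl)).exists
  rw [← show φ (c • gProj F γ v n) = φ (c • ε v) from hn, gProj, ← map_smul, h, map_smul]
  have h2 := B.coeff_mono_self F (γ.g_special v n)
  rw [γ.g_source] at h2
  rw [h2, smul_eq_mul, mul_one]

theorem limIdem_ne_zero (v : V) : ε v ≠ 0 := by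
  obtain ⟨φ, -, h⟩ := exists_coeff_limIdem (F := F) (γ := γ) v
  intro h0
  have h1 := h 1
  have h2 := h 0
  rw [h0, smul_zero] at h1 h2
  exact one_ne_zero (h1.symm.trans h2)

/-- If `a z b = e_v` for suitable `a` and `b`, then the line through `z` is closed. -/
theorem isClosed_span_singleton {v : V} {z a b : Hat F γ} (h : a * z * b = ε v) :
    IsClosed (Submodule.span F {z} : Set (Hat F γ)) := by
  obtain ⟨φ, hφ, h1⟩ := exists_coeff_limIdem (F := F) (γ := γ) v
  -- The line is the set on which `y` and its projection `φ (a y b) z` agree.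
  have : (Submodule.span F {z} : Set (Hat F γ)) = {y | φ (a * y * b) • z = y} := by
    ext y
    simp only [SetLike.mem_coe, Submodule.mem_span_singleton, Set.mem_ofPred_eq]
    constructor
    · rintro ⟨c, rfl⟩
      rw [mul_smul_comm, smul_mul_assoc, h, h1]
    · exact fun hy => ⟨_, hy⟩
  rw [this]
  refine isClosed_eq ?_ continuous_id
  have h2 : IsLocallyConstant fun y => φ (a * y * b) :=
    hφ.comp_continuous (continuous_mul_mul a b)
  exact (h2.comp fun c => c • z).continuous

/-! ### The elements `p e_{r(p)} p*` add up to `1` -/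

/-- An open subgroup that contains `p e_{r(p)} p*` for all paths `p` contains all `q q*` where `q`
does not end on a special edge. Indeed it does so for long `q`, and `q q* - q e_{r(q)} q*` is a
limit of sums of `q' q'*` for longer `q'`. -/
theorem mono_self_mem_of_isOpen {A : AddSubgroup (Hat F γ)} (hA : IsOpen (A : Set (Hat F γ)))
    (h : ∀ p : G.Path, ι (LPA.path F p) * ε p.range * ι (LPA.pathStar F p) ∈ A)
    (q : G.Path) (hq : γ.sd q = 0) : ι (LPA.mono F q q) ∈ A := by
  obtain ⟨k, hk⟩ := exists_subspaceK_le hA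
  induction hm : k - q.length using Nat.strong_induction_on generalizing q with
  | _ m ih =>
  subst hm
  by_cases hkq : k ≤ q.length
  · exact hk _ (mono_self_mem_subspaceK γ hq hkq)
  let x : ℕ → Hat F γ := fun n =>
    ι (LPA.path F q) * gProj F γ q.range n * ι (LPA.pathStar F q)
  have hx : ∀ n, x n = ι (LPA.mono F (q.comp (γ.g q.range n) (γ.g_source _ n).symm)
      (q.comp (γ.g q.range n) (γ.g_source _ n).symm)) := by
    intro n
    simp only [x, gProj]
    rw [LPA.mono, LPA.mono, LPA.path_comp, LPA.pathStar_comp, ← map_mul, ← map_mul]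
    simp only [mul_assoc]
  have hx0 : x 0 = ι (LPA.mono F q q) := by
    rw [LPA.mono_self_eq, map_mul, map_mul]
    simp only [x, gProj, Graph.Specialization.g]
    rw [← LPA.vtx_eq_mono]
    rfl
  have hstep : ∀ n, x n - x (n + 1) ∈ A := by
    intro n
    rw [hx, hx, ← map_sub]
    refine LPA.mono_comp_g_sub_mem γ q (A.comap (ι).toRingHom.toAddMonoidHom) n ?_
    intro q' hq' hl
    exact ih _ (by omega) q' hq' rfl
  have hsub : ∀ n, x 0 - x n ∈ A := by
    intro n
    induction n with
    | zero => rw [sub_self]; exact A.zero_mem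
    | succ n hn => simpa using A.add_mem hn (hstep n)
  have hlim : Tendsto (fun n => x 0 - x n) atTop (𝓝 (x 0 -
      ι (LPA.path F q) * ε q.range * ι (LPA.pathStar F q))) :=
    (((continuous_mul_mul _ _).tendsto _).comp (tendsto_gProj γ _)).const_sub _
  have := (A.isClosed_of_isOpen hA).mem_of_tendsto hlim (Eventually.of_forall hsub)
  rw [← hx0]
  simpa using A.add_mem this (h q)

theorem one_mem_of_isOpen {A : AddSubgroup (Hat F γ)} (hA : IsOpen (A : Set (Hat F γ)))
    (h : ∀ p : G.Path, ι (LPA.path F p) * ε p.range * ι (LPA.pathStar F p) ∈ A) : 1 ∈ A := by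
  rw [← map_one ι, ← LPA.vtx_sum, map_sum]
  refine sum_mem fun v _ => ?_
  have := mono_self_mem_of_isOpen hA h (Graph.Path.nil v) (by simp [Graph.Specialization.sd,
    Graph.Path.nil])
  rwa [← LPA.vtx_eq_mono] at this

theorem exists_mul_ne_zero_left {x : Hat F γ} (hx : x ≠ 0) :
    ∃ p : G.Path, ε p.range * ι (LPA.pathStar F p) * x ≠ 0 := by
  by_contra! h
  refine hx (eq_zero_of_mem_open fun A hA => ?_)
  have := one_mem_of_isOpen (A := A.comap (AddMonoidHom.mulRight x))
    (hA.preimage (continuous_mul_const x)) fun p => ?_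
  · simpa using this
  · simp only [AddSubgroup.mem_comap, AddMonoidHom.coe_mulRight]
    rw [mul_assoc (ι _), mul_assoc, h, mul_zero]
    exact A.zero_mem

theorem exists_mul_ne_zero_right {x : Hat F γ} (hx : x ≠ 0) :
    ∃ p : G.Path, x * (ι (LPA.path F p) * ε p.range) ≠ 0 := by
  by_contra! h
  refine hx (eq_zero_of_mem_open fun A hA => ?_)
  have := one_mem_of_isOpen (A := A.comap (AddMonoidHom.mulLeft x))
    (hA.preimage (continuous_const_mul x)) fun p => ?_
  · simpa using this
  · simp only [AddSubgroup.mem_comap, AddMonoidHom.coe_mulLeft]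
    rw [← mul_assoc, h, zero_mul]
    exact A.zero_mem

end Idempotents

/-! ### Corners, and the ideals that contain some `e_t` -/

section Ideals

variable {V E : Type*} [Fintype V] [Fintype E] {F : Type*} [Field F] {G : Graph V E}
  {γ : G.Specialization}

local notation "ι" => toHat F γ
local notation "ε" => limIdem F γ

/-- Lengthening two paths `p` and `q` by special edges does not change `p e q*`, so this element
is determined by the sources and the difference of the lengths if `p` and `q` are special. -/
theorem path_mul_limIdem_mul_pathStar_eq {p₁ q₁ p₂ q₂ : G.Path} (h₁ : p₁.range = q₁.range)
    (h₂ : p₂.range = q₂.range) (hp : p₁.source = p₂.source) (hq : q₁.source = q₂.source)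
    (hp₁ : ∀ e ∈ p₁.edges, γ.IsSpecial e) (hq₁ : ∀ e ∈ q₁.edges, γ.IsSpecial e)
    (hp₂ : ∀ e ∈ p₂.edges, γ.IsSpecial e) (hq₂ : ∀ e ∈ q₂.edges, γ.IsSpecial e)
    (hd : (p₁.length : ℤ) - q₁.length = (p₂.length : ℤ) - q₂.length) :
    ι (LPA.path F p₁) * ε p₁.range * ι (LPA.pathStar F q₁)
      = ι (LPA.path F p₂) * ε p₂.range * ι (LPA.pathStar F q₂) := by
  wlog hl : p₁.length ≤ p₂.length generalizing p₁ q₁ p₂ q₂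
  · exact (this h₂ h₁ hp.symm hq.symm hp₂ hq₂ hp₁ hq₁ hd.symm (by omega)).symm
  obtain ⟨u, l₁, t₁, w₁⟩ := p₁
  obtain ⟨v, m₁, t₁', x₁⟩ := q₁
  obtain ⟨u', l₂, t₂, w₂⟩ := p₂
  obtain ⟨v', m₂, t₂', x₂⟩ := q₂
  dsimp only [Graph.Path.length] at *
  subst h₁ h₂ hp hq
  obtain ⟨l, rfl, hl1, hl2⟩ := γ.exists_append_of_special w₁ w₂ hp₁ hp₂ hl
  obtain ⟨m, rfl, hm1, hm2⟩ := γ.exists_append_of_special x₁ x₂ hq₁ hq₂ (by omega)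
  simp only [List.length_append] at hd
  obtain ⟨r, hmr, -⟩ := γ.exists_append_of_special hl1 hm1 hl2 hm2 (by omega)
  obtain rfl : r = [] := List.eq_nil_of_length_eq_zero (by
    simp only [hmr, List.length_append] at hd; omega)
  obtain rfl : m = l := hmr.trans (List.append_nil l)
  have h := limIdem_eq_path_mul (F := F) (γ := γ) ⟨t₁, m, t₂, hl1⟩ hl2
  have h1 := LPA.path_comp (F := F) ⟨u, l₁, t₁, w₁⟩ ⟨t₁, m, t₂, hl1⟩ rfl
  have h2 := LPA.pathStar_comp (F := F) ⟨v, m₁, t₁, x₁⟩ ⟨t₁, m, t₂, hl1⟩ rfl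
  simp only [Graph.Path.comp] at h1 h2
  rw [h1, h2]
  dsimp only at h
  rw [h]
  simp only [map_mul, mul_assoc]

/-- The homogeneous components of the corner between `e_u` and `e_w` are at most one-dimensional,
and are spanned by elements that are equivalent to some idempotent `e_t`. -/
theorem exists_span_corner (u w : V) (i : ℤ) :
    (∀ x ∈ hatComponent F γ i, ε u * x * ε w = 0) ∨
    ∃ (z a b : Hat F γ) (t : V), a * z * b = ε t ∧
      ∀ x ∈ hatComponent F γ i, ε u * x * ε w ∈ Submodule.span F {z} := by
  let f : Hat F γ →ₗ[F] Hat F γ := LinearMap.mulRight F (ε w) ∘ₗ LinearMap.mulLeft F (ε u)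
  have key (p q : G.Path) : ε u * ι (LPA.mono F p q) * ε w
      = (ε u * ι (LPA.path F p)) * (ι (LPA.pathStar F q) * ε w) := by
    rw [LPA.mono, map_mul]
    simp only [mul_assoc]
  by_cases h : ∃ p q : G.Path, p.range = q.range ∧ (p.length : ℤ) - q.length = i ∧
    (p.source = u ∧ ∀ e ∈ p.edges, γ.IsSpecial e) ∧ (q.source = w ∧ ∀ e ∈ q.edges, γ.IsSpecial e)
  · obtain ⟨p, q, hr, hd, ⟨rfl, hp⟩, rfl, hq⟩ := h
    right
    have hz : ι (LPA.pathStar F p) * (ι (LPA.path F p) * ε p.range * ι (LPA.pathStar F q))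
        * ι (LPA.path F q) = ε p.range := by
      rw [← mul_assoc, ← mul_assoc, ← map_mul, LPA.pathStar_mul_path, vtx_mul_limIdem, mul_assoc,
        ← map_mul, LPA.pathStar_mul_path, ← hr, limIdem_mul_vtx]
    refine ⟨_, _, _, _, hz, fun x hx => ?_⟩
    refine hatComponent_le (S := (Submodule.span F _).comap f)
      ((isClosed_span_singleton hz).preimage (continuous_mul_mul _ _)) ?_ hx
    intro p' q' hr' hd'
    change ε p.source * ι (LPA.mono F p' q') * ε q.source ∈
      Submodule.span F {ι (LPA.path F p) * ε p.range * ι (LPA.pathStar F q)}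
    rw [key]
    by_cases hp' : p'.source = p.source ∧ ∀ e ∈ p'.edges, γ.IsSpecial e
    swap
    · rw [limIdem_mul_path_eq_zero hp', zero_mul]
      exact Submodule.zero_mem _
    by_cases hq' : q'.source = q.source ∧ ∀ e ∈ q'.edges, γ.IsSpecial e
    swap
    · rw [pathStar_mul_limIdem_eq_zero hq', mul_zero]
      exact Submodule.zero_mem _
    rw [path_mul_limIdem_mul_pathStar_eq hr hr' hp'.1.symm hq'.1.symm hp hq hp'.2 hq'.2
      (hd.trans hd'.symm), ← hp'.1, ← hq'.1, limIdem_mul_path hp'.2, pathStar_mul_limIdem hq'.2, hr',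
      ← mul_assoc (ι (LPA.path F p') * _), mul_assoc (ι (LPA.path F p')) (ε _) (ε _),
      limIdem_mul_self]
    exact Submodule.mem_span_singleton_self _
  · left
    intro x hx
    refine hatComponent_le (S := LinearMap.ker f)
      (isClosed_singleton.preimage (continuous_mul_mul (ε u) (ε w))) ?_ hx
    intro p q hr hd
    change ε u * ι (LPA.mono F p q) * ε w = 0
    rw [key]
    by_cases hp : p.source = u ∧ ∀ e ∈ p.edges, γ.IsSpecial e
    · rw [pathStar_mul_limIdem_eq_zero fun hq => h ⟨p, q, hr, hd, hp, hq⟩, mul_zero]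
    · rw [limIdem_mul_path_eq_zero hp, zero_mul]

theorem mem_hatComponent_of_mul {x : Hat F γ} {i : ℤ} (hx : x ∈ hatComponent F γ i) (p q : G.Path) :
    ι (LPA.pathStar F p) * x * ι (LPA.path F q) ∈ hatComponent F γ (-p.length + i + q.length) := by
  have hp : LPA.pathStar F p ∈ LPA.component F G (-p.length) := by
    refine Submodule.subset_span ⟨.nil p.range, p, rfl, by simp [Graph.Path.nil,
      Graph.Path.length], ?_⟩
    have := LPA.ghostWalk_append (F := F) (l' := []) p.isWalk
    simp [LPA.mono, LPA.path, LPA.pathStar, Graph.Path.nil] at this ⊢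
    exact this.symm
  have hq : LPA.path F q ∈ LPA.component F G q.length := by
    refine Submodule.subset_span ⟨q, .nil q.range, rfl, by simp [Graph.Path.nil,
      Graph.Path.length], ?_⟩
    have := LPA.walk_append (F := F) (l' := []) q.isWalk
    simp [LPA.mono, LPA.path, LPA.pathStar, Graph.Path.nil] at this ⊢
    exact this.symm
  exact fullComponent_mul (F := F) (γ := γ) (fullComponent_mul (toFull_mem_fullComponent hp) hx)
    (toFull_mem_fullComponent hq)

/-- An ideal with a nonzero homogeneous element `x` contains some `e_t`: one of the elements
`e p* x q e` is not zero, and it spans a homogeneous component of a corner. -/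
theorem exists_limIdem_mem {J : TwoSidedIdeal (Hat F γ)} {i : ℤ} {x : Hat F γ} (hx : x ∈ J)
    (hi : x ∈ hatComponent F γ i) (h0 : x ≠ 0) : ∃ t, ε t ∈ J := by
  obtain ⟨p, hp⟩ := exists_mul_ne_zero_left h0
  obtain ⟨q, hq⟩ := exists_mul_ne_zero_right hp
  have hi' := mem_hatComponent_of_mul hi p q
  have heq : ε p.range * ι (LPA.pathStar F p) * x * (ι (LPA.path F q) * ε q.range)
      = ε p.range * (ι (LPA.pathStar F p) * x * ι (LPA.path F q)) * ε q.range := by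
    simp only [mul_assoc]
  have hJ := J.mul_mem_right _ (ι (LPA.path F q) * ε q.range)
    (J.mul_mem_left (ε p.range * ι (LPA.pathStar F p)) _ hx)
  rw [heq] at hq hJ
  rcases exists_span_corner (F := F) (γ := γ) p.range q.range _ with h | ⟨z, a, b, t, hz, h⟩
  · exact absurd (h _ hi') hq
  · obtain ⟨c, hc⟩ := Submodule.mem_span_singleton.1 (h _ hi')
    have hc0 : c ≠ 0 := by
      rintro rfl
      rw [zero_smul] at hc
      exact hq hc.symm
    have hzJ : z ∈ J := by
      have := J.mul_mem_left (algebraMap F _ c⁻¹) _ hJ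
      rwa [← hc, ← Algebra.smul_def, inv_smul_smul₀ hc0] at this
    exact ⟨t, hz ▸ J.mul_mem_right _ _ (J.mul_mem_left _ _ hzJ)⟩

theorem exists_limIdem_mem_of_isGradedIdeal {J : TwoSidedIdeal (Hat F γ)} (hJ : IsGradedIdeal J)
    (h : J ≠ ⊥) : ∃ t, ε t ∈ J := by
  by_contra hne
  refine h (eq_bot_iff.2 fun x hx => ?_)
  rw [TwoSidedIdeal.mem_bot]
  refine (AddSubgroup.closure_le (⊥ : AddSubgroup (Hat F γ))).2 ?_ (hJ x hx)
  rintro y ⟨hy, i, hi⟩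
  by_contra h0
  exact hne (exists_limIdem_mem hy hi h0)

/-- The ideal of all `x` such that `a L̂(Γ) x = 0`. -/
def annihilatorOf (a : Hat F γ) : TwoSidedIdeal (Hat F γ) :=
  .mk' {x | ∀ y, a * y * x = 0} (fun y => mul_zero _)
    (fun hx hx' y => by rw [mul_add, hx y, hx' y, add_zero])
    (fun hx y => by rw [mul_neg, hx y, neg_zero])
    (fun {b x} hx y => by rw [← mul_assoc, mul_assoc a, hx])
    (fun {x b} hx y => by rw [← mul_assoc, hx y, zero_mul])

theorem mem_annihilatorOf {a x : Hat F γ} : x ∈ annihilatorOf a ↔ ∀ y, a * y * x = 0 := by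
  simp [annihilatorOf]

theorem isClosedIdeal_annihilatorOf (a : Hat F γ) : IsClosedIdeal (annihilatorOf a) := by
  have : {x : Hat F γ | x ∈ annihilatorOf a} = ⋂ y, (fun x => a * y * x) ⁻¹' {0} := by
    ext x
    simp [mem_annihilatorOf]
  rw [IsClosedIdeal, this]
  exact isClosed_iInter fun y => isClosed_singleton.preimage (continuous_const_mul (a * y))

/-- If `e_t` lies in `I(W)` then the special edges lead from `t` to `W`: otherwise
`e_t L̂(Γ) w = 0` for all `w ∈ W`, so that `I(W)` annihilates `e_t`. -/
theorem exists_special_path_of_mem_idealOf {W : Set V} (hW : G.IsHereditary W) {t : V}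
    (ht : ε t ∈ idealOf F γ W) :
    ∃ p : G.Path, p.source = t ∧ (∀ e ∈ p.edges, γ.IsSpecial e) ∧ p.range ∈ W := by
  by_contra h
  have hle : idealOf F γ W ≤ annihilatorOf (ε t) := by
    refine sInf_le ⟨isClosedIdeal_annihilatorOf _, fun w hw => mem_annihilatorOf.2 fun y => ?_⟩
    let f : Hat F γ →ₗ[F] Hat F γ :=
      LinearMap.mulRight F (ι (LPA.vtx F G w)) ∘ₗ LinearMap.mulLeft F (ε t)
    have htop : LinearMap.ker f = ⊤ := by
      refine eq_top_of_mono_mem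
        (isClosed_singleton.preimage (continuous_mul_mul (ε t) (ι (LPA.vtx F G w)))) ?_
      intro p q hr
      change ε t * ι (LPA.mono F p q) * ι (LPA.vtx F G w) = 0
      by_cases hp : p.source = t ∧ ∀ e ∈ p.edges, γ.IsSpecial e
      · have hq : q.source ≠ w := by
          rintro rfl
          exact h ⟨p, hp.1, hp.2, hW.2 _ hw _ ⟨q, rfl, hr.symm⟩⟩
        rw [mul_assoc, ← map_mul, LPA.mono, LPA.pathStar, mul_assoc, mul_assoc,
          LPA.vtx_mul_ne hq, mul_zero, mul_zero, map_zero, mul_zero]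
      · rw [LPA.mono, map_mul, ← mul_assoc, limIdem_mul_path_eq_zero hp, zero_mul, zero_mul]
    exact LinearMap.mem_ker.1 (htop ▸ Submodule.mem_top : y ∈ LinearMap.ker f)
  have h0 := mem_annihilatorOf.1 (hle ht) 1
  rw [mul_one, limIdem_mul_self] at h0
  exact limIdem_ne_zero t h0

theorem not_isNilpotentIdeal {J : TwoSidedIdeal (Hat F γ)} {t : V} (h : ε t ∈ J) :
    ¬ IsNilpotentIdeal J := by
  rintro ⟨n, hn⟩
  have h1 := hn (List.replicate n (ε t)) (List.length_replicate ..)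
    fun x hx => (List.eq_of_mem_replicate hx) ▸ h
  rw [List.prod_replicate] at h1
  have h2 : ε t ^ (n + 1) = ε t := (show IsIdempotentElem (ε t) from limIdem_mul_self t).pow_succ_eq n
  rw [pow_succ, h1, zero_mul] at h2
  exact limIdem_ne_zero t h2.symm

end Ideals

end Leavitt

end

theorem lemma23 {V E : Type*} [Fintype V] [Fintype E] {F : Type*} [Field F]
    (G : Leavitt.Graph V E) (γ : G.Specialization) :
    (∀ W : Set V, G.IsHereditary W →
      ∀ J : TwoSidedIdeal (Leavitt.Hat F γ),
        Leavitt.IsClosedIdeal J → Leavitt.IsGradedIdeal J → J ≠ ⊥ →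
        J ≤ Leavitt.idealOf F γ W →
        ∃ w ∈ W, Tendsto (Leavitt.gProj F γ w) atTop (𝓝 (Leavitt.limIdem F γ w)) ∧
          Leavitt.limIdem F γ w ∈ J) ∧
    (∀ J : TwoSidedIdeal (Leavitt.Hat F γ),
        Leavitt.IsClosedIdeal J → Leavitt.IsGradedIdeal J → Leavitt.IsNilpotentIdeal J →
        J = ⊥) := by
  constructor
  · intro W hW J _ hJ hne hle
    obtain ⟨t, ht⟩ := Leavitt.exists_limIdem_mem_of_isGradedIdeal hJ hne
    obtain ⟨p, rfl, hp, hpW⟩ := Leavitt.exists_special_path_of_mem_idealOf hW (hle ht)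
    refine ⟨p.range, hpW, Leavitt.tendsto_gProj γ _, ?_⟩
    rw [← Leavitt.pathStar_mul_limIdem_mul_path hp]
    exact J.mul_mem_right _ _ (J.mul_mem_left _ _ ht)
  · intro J _ hJ hn
    by_contra hne
    obtain ⟨t, ht⟩ := Leavitt.exists_limIdem_mem_of_isGradedIdeal hJ hne
    exact Leavitt.not_isNilpotentIdeal ht hn
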